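/- **Setting.** Let $\ell\ge 0$ be an integer, $\Delta=2^\ell$, and let $G_\Delta=\{(i/\Delta,j/\Delta): 0\le i,j\le \Delta-1\}\subset[0,1)^2$ with the $\ell_1$ metric. For distributions $p,q$ on $G_\Delta$ let $\mathrm{EMD}(p,q)=\min_\gamma\sum_{x,y}\gamma(x,y)\|x-y\|_1$, the minimum being over all couplings $\gamma$ of $p$ and $q$. A distribution is $k$-sparse if it is non-zero on at most $k$ points. A dataset $X$ is a finite collection $p_1,\dots,p_n$ of distributions on $G_\Delta$ (one per user); two datasets are neighbors if one is obtained from the other by adding or removing one user. A mechanism $M$ (a random output for each dataset) is $\varepsilon$-DP if $\Pr[M(X)\in O]\le e^\varepsilon\Pr[M(X')\in O]$ for all neighbors $X,X'$ and all (measurable) sets $O$ of outputs. **Algorithm.** For $0\le i\le\ell$ let $C_{2^i}$ be the set of the $4^i$ cells $[a,a+2^{-i})\times[b,b+2^{-i})$ with $(a,b)\in G_{2^i}$; for $s\in\mathbb R^{G_\Delta}$ let $(P_is)(c)=\sum_{x\in c}s(x)$ for $c\in C_{2^i}$, and let $Ps=(2^{-i}P_is)_{0\le i\le\ell}$ be the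 scaled pyramidal transform. The children of a level-$i$ cell are the four level-$(i+1)$ cells contained in it. Given parameters $w\in\mathbb N$ and $\varepsilon_0,\dots,\varepsilon_\ell>0$, on input $p_1,\dots,p_n$: 1. Let $s=\sum_{j}p_j$ and $y'_i=2^{-i}(P_is+\nu_i)$ for $0\le i\le\ell$, where all coordinates of $\nu_0,\dots,\nu_\ell$ are independent and those of $\nu_i$ have the Laplace distribution $\mathrm{Lap}(1/\varepsilon_i)$. 2. Let $S_0=C_1$; for $i=1,\dots,\ell$ let $T_i$ be the set of children of the cells in $S_{i-1}$ and let $S_i$ consist of $\min\{w,|T_i|\}$ cells of $T_i$ with the largest values of $y'$. Let $\hat y$ be $y'$ restricted to $\bigcup_iS_i$ (zero elsewhere). 3. Let $\hat s\in\arg\min_{s'\ge 0}\|\hat y-Ps'\|_1$ and output $\hat a=\hat s/\|\hat s\|_1$ (the uniform distribution if $\hat s=0$). **Theorem.** There is an absolute constant $C>0$ such that for all $\varepsilon>0$, $\lambda\in(0,1)$, all $\ell\ge 0$ and all integers $k\ge1$ there are parameters $w\ge 1$ and $\varepsilon_0,\dots,\varepsilon_\ell>0$ (not depending on $n$ or on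 the data) such that steps 2 and 3 admit a measurable rule for breaking ties in step 2 and choosing a minimizer in step 3, and for every such rule the algorithm is $\varepsilon$-DP and, for every $n\ge1$ and all distributions $p_1,\dots,p_n$ on $G_\Delta$ with average $a=\frac1n\sum_jp_j$, with probability at least $0.99$ its output satisfies $$\mathrm{EMD}(\hat a,a)\;\le\;\lambda\cdot\min_{a'\ k\text{-sparse distribution}}\mathrm{EMD}(a',a)\;+\;C\cdot\frac{\sqrt k}{\lambda\varepsilon n}.$$ -/

import Mathlib

open MeasureTheory

noncomputable section

namespace SparseEMD

/-- Index set of the `2^i × 2^i` grid; it indexes both the grid points of `G_{2^i}` and the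
level-`i` grid cells `C_{2^i}`. -/
abbrev Grid (i : ℕ) : Type := Fin (2 ^ i) × Fin (2 ^ i)

/-- The point `(a / 2^i, b / 2^i)` of `[0,1)²`. -/
def point {i : ℕ} (x : Grid i) : ℝ × ℝ := ((x.1 : ℕ) / 2 ^ i, (x.2 : ℕ) / 2 ^ i)

/-- The half-open cell `[a, a + 2^{-i}) × [b, b + 2^{-i})` with lower left corner `(a, b) ∈ G_{2^i}`. -/
def cell {i : ℕ} (c : Grid i) : Set (ℝ × ℝ) :=
  Set.Ico (point c).1 ((point c).1 + ((2 : ℝ) ^ i)⁻¹) ×ˢ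
    Set.Ico (point c).2 ((point c).2 + ((2 : ℝ) ^ i)⁻¹)

/-- The `ℓ₁` distance between two grid points. -/
def l1Dist {ℓ : ℕ} (x y : Grid ℓ) : ℝ :=
  |(point x).1 - (point y).1| + |(point x).2 - (point y).2|

/-- Probability distributions on the grid `G_Δ`, `Δ = 2^ℓ`. -/
abbrev Dist (ℓ : ℕ) : Type := stdSimplex ℝ (Grid ℓ)

/-- Transport plans (couplings) with marginals `p` and `q`. -/
def couplings {ℓ : ℕ} (p q : Grid ℓ → ℝ) : Set (Grid ℓ → Grid ℓ → ℝ) :=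
  {γ | (∀ x y, 0 ≤ γ x y) ∧ (∀ x, ∑ y, γ x y = p x) ∧ (∀ y, ∑ x, γ x y = q y)}

/-- Earth Mover's Distance with respect to the `ℓ₁` metric on the grid (for non-negative vectors
of equal total mass). -/
def emd {ℓ : ℕ} (p q : Grid ℓ → ℝ) : ℝ :=
  sInf ((fun γ => ∑ x, ∑ y, γ x y * l1Dist x y) '' couplings p q)

/-- `k`-sparse distributions: non-zero on at most `k` points. -/
def sparseDists (ℓ k : ℕ) : Set (Grid ℓ → ℝ) :=
  {p | p ∈ stdSimplex ℝ (Grid ℓ) ∧ (Function.support p).ncard ≤ k}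

/-- The EMD from `a` to the best `k`-sparse distribution. -/
def bestSparseError {ℓ : ℕ} (k : ℕ) (a : Grid ℓ → ℝ) : ℝ :=
  sInf ((fun a' => emd a' a) '' sparseDists ℓ k)

/-- `b` is a `(lam, κ)`-approximation for the `k`-sparse EMD aggregation problem with target `a`. -/
def IsApproximation {ℓ : ℕ} (k : ℕ) (lam κ : ℝ) (a : Grid ℓ → ℝ) (b : Dist ℓ) : Prop :=
  emd (b : Grid ℓ → ℝ) a ≤ lam * bestSparseError k a + κ

/-! ### Datasets and differential privacy -/

/-- A dataset is a finite collection of users' distributions. -/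
abbrev Dataset (ℓ : ℕ) : Type := Multiset (Dist ℓ)

/-- The sum `s = ∑ pᵢ` of the users' distributions. -/
def total {ℓ : ℕ} (X : Dataset ℓ) : Grid ℓ → ℝ :=
  (X.map (fun p : Dist ℓ => (p : Grid ℓ → ℝ))).sum

/-- The average `a = (1/n) ∑ pᵢ`, where `n` is the number of users. -/
def average {ℓ : ℕ} (X : Dataset ℓ) : Grid ℓ → ℝ := (X.card : ℝ)⁻¹ • total X

/-- `X'` results from `X` by adding or removing a single user's data. -/
def Neighbors {ℓ : ℕ} (X X' : Dataset ℓ) : Prop :=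
  ∃ p : Dist ℓ, X' = p ::ₘ X ∨ X = p ::ₘ X'

/-- A randomized mechanism, given by its output law on every dataset. -/
abbrev Mechanism (ℓ : ℕ) : Type := Dataset ℓ → Measure (Dist ℓ)

/-- Pure `ε`-differential privacy of a randomized mechanism. -/
def IsDP {ℓ : ℕ} (ε : ℝ) (M : Mechanism ℓ) : Prop :=
  (∀ X, IsProbabilityMeasure (M X)) ∧
    ∀ X X', Neighbors X X' → ∀ O : Set (Dist ℓ), MeasurableSet O →
      M X O ≤ ENNReal.ofReal (Real.exp ε) * M X' O

/-! ### The pyramidal transform -/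

/-- All grid cells of levels `0, …, ℓ`. -/
abbrev Cell (ℓ : ℕ) : Type := Σ i : Fin (ℓ + 1), Grid i

open Classical in
/-- The level-`i` grid partition map `P_i` applied to `s`: the mass of `s` in each level-`i` cell. -/
def levelSum {ℓ : ℕ} (s : Grid ℓ → ℝ) {i : ℕ} (c : Grid i) : ℝ :=
  ∑ p : Grid ℓ, if point p ∈ cell c then s p else 0

/-- The scaled pyramidal transform `P s`. -/
def pyramid {ℓ : ℕ} (s : Grid ℓ → ℝ) (c : Cell ℓ) : ℝ :=
  ((2 : ℝ) ^ (c.1 : ℕ))⁻¹ * levelSum s c.2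

/-! ### Noisy measurements -/

/-- The centred Laplace distribution with scale `b`. -/
def laplace (b : ℝ) : Measure ℝ :=
  volume.withDensity (fun x => ENNReal.ofReal ((2 * b)⁻¹ * Real.exp (-|x| / b)))

/-- Independent noise, `Lap(1/ε_i)` for every level-`i` cell. -/
def noise {ℓ : ℕ} (levelEps : Fin (ℓ + 1) → ℝ) : Measure (Cell ℓ → ℝ) :=
  Measure.pi (fun c : Cell ℓ => laplace (1 / levelEps c.1))

/-- The noisy measurements `y'_i = 2^{-i} (P_i s + ν_i)`. -/
def measurements {ℓ : ℕ} (s : Grid ℓ → ℝ) (ν : Cell ℓ → ℝ) (c : Cell ℓ) : ℝ :=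
  ((2 : ℝ) ^ (c.1 : ℕ))⁻¹ * (levelSum s c.2 + ν c)

/-! ### Reconstruction -/

open Classical in
/-- The set of children of a set of level-`i` cells. -/
def children {i : ℕ} (S : Finset (Grid i)) : Finset (Grid (i + 1)) :=
  Finset.univ.filter (fun d => ∃ c ∈ S, cell d ⊆ cell c)

/-- `S 0, …, S ℓ` is a possible outcome of the greedy tree search with width `w` on the
measurements `y`: `S 0` consists of the root, and `S (i + 1)` consists of
`min {w, |T|}` cells of `T = children (S i)` with maximum values of `y` (ties broken arbitrarily). -/
def IsGreedyTree {ℓ : ℕ} (w : ℕ) (y : Cell ℓ → ℝ) (S : ∀ i : ℕ, Finset (Grid i)) : Prop :=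
  S 0 = Finset.univ ∧
  ∀ (i : ℕ) (hi : i + 1 < ℓ + 1),
    S (i + 1) ⊆ children (S i) ∧
    (S (i + 1)).card = min w (children (S i)).card ∧
    ∀ p ∈ S (i + 1), ∀ q ∈ children (S i), q ∉ S (i + 1) →
      y ⟨⟨i + 1, hi⟩, q⟩ ≤ y ⟨⟨i + 1, hi⟩, p⟩

open Classical in
/-- The restriction of `y` to the cells in `⋃ i, S i`. -/
def restrictTo {ℓ : ℕ} (y : Cell ℓ → ℝ) (S : ∀ i : ℕ, Finset (Grid i)) (c : Cell ℓ) : ℝ :=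
  if c.2 ∈ S (c.1 : ℕ) then y c else 0

/-- `s` minimizes `‖z - P s'‖₁` over all `s' ≥ 0`. -/
def IsLPSolution {ℓ : ℕ} (z : Cell ℓ → ℝ) (s : Grid ℓ → ℝ) : Prop :=
  0 ≤ s ∧ ∀ s' : Grid ℓ → ℝ, 0 ≤ s' →
    ∑ c, |z c - pyramid s c| ≤ ∑ c, |z c - pyramid s' c|

/-- `R` implements the reconstruction procedure of width `w`, with some measurable rule for
breaking ties in the greedy search and for choosing among the minimizers of the linear program. -/
def IsReconstruct {ℓ : ℕ} (w : ℕ) (R : (Cell ℓ → ℝ) → (Grid ℓ → ℝ)) : Prop :=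
  Measurable R ∧
  ∀ y, ∃ S : ∀ i : ℕ, Finset (Grid i), IsGreedyTree w y S ∧ IsLPSolution (restrictTo y S) (R y)

/-- `s / ‖s‖₁` for a non-zero `s ≥ 0`; the uniform distribution otherwise. -/
def normalize {ℓ : ℕ} (s : Grid ℓ → ℝ) : Dist ℓ :=
  open Classical in
  if h : 0 ≤ s ∧ s ≠ 0 then
    ⟨(∑ x, s x)⁻¹ • s, by
      have hpos : 0 < ∑ x, s x := by
        obtain ⟨x, hx⟩ := Function.ne_iff.mp h.2
        exact Finset.sum_pos' (fun y _ => h.1 y)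
          ⟨x, Finset.mem_univ x, lt_of_le_of_ne (h.1 x) (Ne.symm hx)⟩
      refine ⟨fun x => mul_nonneg (inv_nonneg.mpr hpos.le) (h.1 x), ?_⟩
      simp only [Pi.smul_apply, smul_eq_mul, ← Finset.mul_sum]
      exact inv_mul_cancel₀ hpos.ne'⟩
  else stdSimplex.barycenter

/-- The mechanism: draw the noise, form the noisy measurements of the sum of the users'
distributions, reconstruct, and normalize. -/
def dpSparseEMDAgg {ℓ : ℕ} (levelEps : Fin (ℓ + 1) → ℝ)
    (R : (Cell ℓ → ℝ) → (Grid ℓ → ℝ)) : Mechanism ℓ :=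
  fun X => (noise levelEps).map (fun ν => normalize (R (measurements (total X) ν)))

end SparseEMD

end

namespace SparseEMD

/-! Write `s = n • a`. Since `emd p q ≤ 2 * ‖P p - P q‖₁` (`emd_le_sum_abs_pyramid`: match mass
bottom-up, inside ever larger cells), it suffices to reconstruct `s` well in the pyramidal norm. The
minimization costs a factor 2 and the normalization is harmless (`emd_normalize_le`), so the
question is how well the restricted measurements approximate `P s`.

The greedy tree is compared with a reference tree `near r T`: the cells within `r` indices of the
support `T` of a sparse `a'`. It has at most `k * (2 * r + 1) ^ 2 = w` cells per level. Mass
transported over a distance `D` leaves it only at levels with `r * 2^{-i} ≤ D`, a geometric series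
of weights, so the part of `P a` outside it is at most `2 / r` times the transport cost
(`sum_pyramid_far_le`); `r ≈ 96 / λ` turns this into the factor `λ`. What the greedy tree misses of
the reference tree is charged, level by level, to kept cells outside that tree and to noise.
Descendants of a missed cell carry the same mass at half the weight per level, so errors do not
accumulate over the levels (`sum_pyramid_missed_le`).

Only noise on candidate cells enters. Whether a cell is a candidate depends on coarser levels alone,
hence is independent of its own noise, and almost surely level `i` has at most `min (4 ^ i) (4 * w)`
candidates (`lintegral_candidateNoise_le`). With optimal budgets the expected noise is `O(√w / ε) =
O(√k / (λ ε))` (`exists_levelEps`), and Markov's inequality gives probability `0.99`. Privacy holds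
because a user contributes mass exactly 1 to each level, so that the level budgets add up to `ε`
(`isDP_dpSparseEMDAgg`); the rest is post-processing. A measurable reconstruction exists by
enumerating trees and choosing minimizers of least Euclidean norm (`exists_isReconstruct`). -/

/-! ### Geometry of the grid -/

/-- The index of the level-`i` cell containing a given grid point. -/
def anc {ℓ : ℕ} (i : ℕ) (x : Grid ℓ) : Grid i :=
  (⟨x.1 * 2 ^ i / 2 ^ ℓ, Nat.div_lt_of_lt_mul (by
      exact Nat.mul_lt_mul_of_pos_right x.1.2 (Nat.two_pow_pos i))⟩,
   ⟨x.2 * 2 ^ i / 2 ^ ℓ, Nat.div_lt_of_lt_mul (by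
      exact Nat.mul_lt_mul_of_pos_right x.2.2 (Nat.two_pow_pos i))⟩)

/-- Reduces the geometry of dyadic cells to division of natural numbers. -/
lemma mem_Ico_iff_div_eq (a b i l : ℕ) :
    ((a : ℝ) / 2 ^ l ∈ Set.Ico ((b : ℝ) / 2 ^ i) ((b : ℝ) / 2 ^ i + ((2 : ℝ) ^ i)⁻¹)) ↔
      a * 2 ^ i / 2 ^ l = b := by
  have h1 : (b : ℝ) / 2 ^ i + ((2 : ℝ) ^ i)⁻¹ = ((b + 1 : ℕ) : ℝ) / 2 ^ i := by
    push_cast; ring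
  rw [Nat.div_eq_iff (by positivity), h1, Set.mem_Ico, div_le_div_iff₀ (by positivity)
    (by positivity), div_lt_div_iff₀ (by positivity) (by positivity)]
  have h2 : 0 < 2 ^ l := by positivity
  constructor
  · rintro ⟨h3, h4⟩
    have h5 : b * 2 ^ l ≤ a * 2 ^ i := by exact_mod_cast h3
    have h6 : a * 2 ^ i < (b + 1) * 2 ^ l := by exact_mod_cast h4
    rw [add_mul] at h6
    constructor <;> omega
  · rintro ⟨h3, h4⟩
    have h6 : a * 2 ^ i < (b + 1) * 2 ^ l := by rw [add_mul]; omega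
    exact ⟨by exact_mod_cast h3, by exact_mod_cast h6⟩

lemma point_mem_cell_iff {ℓ i : ℕ} (x : Grid ℓ) (c : Grid i) :
    point x ∈ cell c ↔ anc i x = c := by
  rw [cell, Set.mem_prod, point, point]
  simp only [mem_Ico_iff_div_eq, anc, Prod.ext_iff, Fin.ext_iff]

lemma levelSum_eq {ℓ i : ℕ} (s : Grid ℓ → ℝ) (c : Grid i) :
    levelSum s c = ∑ x with anc i x = c, s x := by
  simp only [levelSum, point_mem_cell_iff, Finset.sum_filter]

lemma anc_anc {ℓ i j : ℕ} (h : i ≤ j) (x : Grid ℓ) : anc i (anc j x) = anc i x := by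
  have key : ∀ a : ℕ, a * 2 ^ j / 2 ^ ℓ * 2 ^ i / 2 ^ j = a * 2 ^ i / 2 ^ ℓ := by
    intro a
    obtain ⟨d, rfl⟩ := Nat.exists_eq_add_of_le h
    have h1 : a * 2 ^ (i + d) / 2 ^ ℓ * 2 ^ i / 2 ^ (i + d)
        = a * 2 ^ (i + d) / 2 ^ ℓ / 2 ^ d := by
      rw [pow_add, mul_comm (2 ^ i) (2 ^ d), Nat.mul_div_mul_right _ _ (by positivity)]
    rw [h1, Nat.div_div_eq_div_mul, pow_add, ← mul_assoc,
      Nat.mul_div_mul_right _ _ (by positivity)]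
  simp only [anc, key]

lemma anc_self {ℓ : ℕ} (x : Grid ℓ) : anc ℓ x = x := by
  simp [anc]

lemma cell_subset_iff {i j : ℕ} (h : i ≤ j) (d : Grid j) (c : Grid i) :
    cell d ⊆ cell c ↔ anc i d = c := by
  constructor
  · intro hs
    rw [← point_mem_cell_iff]
    -- `point d` is the lower left corner of `cell d`.
    exact hs ((point_mem_cell_iff d d).2 (anc_self d))
  · have key : ∀ (d : ℕ) (x : ℝ),
        x ∈ Set.Ico ((d : ℝ) / 2 ^ j) ((d : ℝ) / 2 ^ j + ((2 : ℝ) ^ j)⁻¹) →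
        x ∈ Set.Ico (((d * 2 ^ i / 2 ^ j : ℕ) : ℝ) / 2 ^ i)
          (((d * 2 ^ i / 2 ^ j : ℕ) : ℝ) / 2 ^ i + ((2 : ℝ) ^ i)⁻¹) := by
      clear d c
      intro d x hx
      obtain ⟨e, rfl⟩ := Nat.exists_eq_add_of_le h
      have h0 : d * 2 ^ i / 2 ^ (i + e) = d / 2 ^ e := by
        rw [pow_add, mul_comm (2 ^ i) (2 ^ e), Nat.mul_div_mul_right _ _ (by positivity)]
      rw [h0]
      set q := d / 2 ^ e
      have h1 : q * 2 ^ e ≤ d := Nat.div_mul_le_self _ _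
      have h2 : d + 1 ≤ (q + 1) * 2 ^ e := Nat.lt_mul_of_div_lt (Nat.lt_succ_self _) (by positivity)
      have h1' : (q : ℝ) * 2 ^ e ≤ d := by exact_mod_cast h1
      have h2' : (d : ℝ) + 1 ≤ (q + 1) * 2 ^ e := by exact_mod_cast h2
      constructor
      · refine le_trans ?_ hx.1
        rw [div_le_div_iff₀ (by positivity) (by positivity), pow_add]
        nlinarith [show (0 : ℝ) < 2 ^ i by positivity]
      · refine lt_of_lt_of_le hx.2 ?_
        have e1 : (d : ℝ) / 2 ^ (i + e) + ((2 : ℝ) ^ (i + e))⁻¹ = (d + 1) / 2 ^ (i + e) := by ring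
        have e2 : (q : ℝ) / 2 ^ i + ((2 : ℝ) ^ i)⁻¹ = (q + 1) / 2 ^ i := by ring
        rw [e1, e2, div_le_div_iff₀ (by positivity) (by positivity), pow_add]
        nlinarith [show (0 : ℝ) < 2 ^ i by positivity]
    rintro rfl x hx
    exact ⟨key _ _ hx.1, key _ _ hx.2⟩

lemma mem_children {i : ℕ} {S : Finset (Grid i)} {d : Grid (i + 1)} :
    d ∈ children S ↔ anc i d ∈ S := by
  simp [children, cell_subset_iff (Nat.le_succ i)]

/-- A child is determined by its parent and the parities of its two indices. -/
lemma card_children_le {i : ℕ} (S : Finset (Grid i)) : (children S).card ≤ 4 * S.card := by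
  have : (children S).card ≤ (S ×ˢ (Finset.univ : Finset (Fin 2 × Fin 2))).card := by
    refine Finset.card_le_card_of_injOn
      (fun d => (anc i d, (⟨d.1 % 2, Nat.mod_lt _ two_pos⟩, ⟨d.2 % 2, Nat.mod_lt _ two_pos⟩))) ?_ ?_
    · intro d hd
      simpa using mem_children.1 hd
    · intro d _ d' _ h
      have h0 : ∀ a : ℕ, a * 2 ^ i / 2 ^ (i + 1) = a / 2 := by
        intro a
        rw [pow_succ, mul_comm (2 ^ i) 2, Nat.mul_div_mul_right _ _ (by positivity)]
      simp only [anc, Prod.mk.injEq, Fin.mk.injEq, h0] at h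
      refine Prod.ext (Fin.ext ?_) (Fin.ext ?_) <;> omega
  simpa [mul_comm] using this

lemma card_grid (i : ℕ) : Fintype.card (Grid i) = 4 ^ i := by
  simp [← mul_pow]

/-! ### Level sums -/

lemma sum_levelSum {ℓ : ℕ} (i : ℕ) (s : Grid ℓ → ℝ) :
    ∑ c : Grid i, levelSum s c = ∑ x, s x := by
  simp only [levelSum_eq]
  exact Finset.sum_fiberwise _ _ _

lemma sum_levelSum_filter {ℓ : ℕ} (i : ℕ) (s : Grid ℓ → ℝ) (p : Grid i → Prop)
    [DecidablePred p] :
    ∑ c with p c, levelSum s c = ∑ x with p (anc i x), s x := by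
  simp only [levelSum_eq, Finset.sum_filter]
  simp only [← Finset.sum_filter (fun x => anc i x = _)]
  rw [← Finset.sum_fiberwise Finset.univ (anc i) (fun x => if p (anc i x) then s x else 0)]
  refine Finset.sum_congr rfl fun c _ => ?_
  split_ifs with h
  · exact Finset.sum_congr rfl fun x hx => by rw [(Finset.mem_filter.1 hx).2, if_pos h]
  · exact (Finset.sum_eq_zero fun x hx => by rw [(Finset.mem_filter.1 hx).2, if_neg h]).symm

lemma levelSum_nonneg {ℓ i : ℕ} {s : Grid ℓ → ℝ} (hs : 0 ≤ s) (c : Grid i) : 0 ≤ levelSum s c := by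
  rw [levelSum_eq]
  exact Finset.sum_nonneg fun x _ => hs x

lemma levelSum_eq_sum_children {ℓ i j : ℕ} (h : i ≤ j) (s : Grid ℓ → ℝ) (c : Grid i) :
    levelSum s c = ∑ d : Grid j with anc i d = c, levelSum s d := by
  rw [sum_levelSum_filter, levelSum_eq]
  simp only [anc_anc h]

lemma levelSum_sub {ℓ i : ℕ} (s t : Grid ℓ → ℝ) (c : Grid i) :
    levelSum (s - t) c = levelSum s c - levelSum t c := by
  simp [levelSum_eq, Finset.sum_sub_distrib]

lemma levelSum_add {ℓ i : ℕ} (s t : Grid ℓ → ℝ) (c : Grid i) :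
    levelSum (s + t) c = levelSum s c + levelSum t c := by
  simp [levelSum_eq, Finset.sum_add_distrib]

lemma levelSum_smul {ℓ i : ℕ} (r : ℝ) (s : Grid ℓ → ℝ) (c : Grid i) :
    levelSum (r • s) c = r * levelSum s c := by
  simp [levelSum_eq, Finset.mul_sum]

lemma pyramid_sub {ℓ : ℕ} (s t : Grid ℓ → ℝ) (c : Cell ℓ) :
    pyramid (s - t) c = pyramid s c - pyramid t c := by
  simp [pyramid, levelSum_sub, mul_sub]

lemma pyramid_smul {ℓ : ℕ} (r : ℝ) (s : Grid ℓ → ℝ) (c : Cell ℓ) :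
    pyramid (r • s) c = r * pyramid s c := by
  simp only [pyramid, levelSum_smul]; ring

lemma pyramid_nonneg {ℓ : ℕ} {s : Grid ℓ → ℝ} (hs : 0 ≤ s) (c : Cell ℓ) : 0 ≤ pyramid s c :=
  mul_nonneg (by positivity) (levelSum_nonneg hs _)

lemma sum_inv_two_pow_le (n : ℕ) : ∑ i : Fin (n + 1), ((2 : ℝ) ^ (i : ℕ))⁻¹ ≤ 2 := by
  rw [Fin.sum_univ_eq_sum_range (fun i => ((2 : ℝ) ^ i)⁻¹)]
  simpa using sum_geometric_two_le (n + 1)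

lemma sum_pyramid_le {ℓ : ℕ} {s : Grid ℓ → ℝ} (hs : 0 ≤ s) :
    ∑ c, pyramid s c ≤ 2 * ∑ x, s x := by
  rw [Fintype.sum_sigma]
  simp only [pyramid, ← Finset.mul_sum, sum_levelSum]
  rw [← Finset.sum_mul]
  exact mul_le_mul_of_nonneg_right (sum_inv_two_pow_le ℓ) (Finset.sum_nonneg fun x _ => hs x)

/-- The cell of level `0`. -/
def root (ℓ : ℕ) : Cell ℓ := ⟨0, (0, 0)⟩

lemma pyramid_root {ℓ : ℕ} (s : Grid ℓ → ℝ) : pyramid s (root ℓ) = ∑ x, s x := by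
  have : Subsingleton (Grid 0) := inferInstanceAs (Subsingleton (Fin 1 × Fin 1))
  have h := sum_levelSum 0 s
  rw [Fintype.sum_eq_single ((0, 0) : Grid 0) fun c hc => absurd (Subsingleton.elim c _) hc] at h
  calc pyramid s (root ℓ) = ((2 : ℝ) ^ 0)⁻¹ * levelSum s ((0, 0) : Grid 0) := rfl
    _ = _ := by rw [h]; simp

lemma abs_sum_le_sum_abs_pyramid {ℓ : ℕ} (s : Grid ℓ → ℝ) :
    |∑ x, s x| ≤ ∑ c, |pyramid s c| := by
  rw [← pyramid_root]
  exact Finset.single_le_sum (f := fun c => |pyramid s c|) (fun c _ => abs_nonneg _)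
    (Finset.mem_univ _)

lemma l1Dist_nonneg {ℓ : ℕ} (x y : Grid ℓ) : 0 ≤ l1Dist x y := by unfold l1Dist; positivity

lemma l1Dist_self {ℓ : ℕ} (x : Grid ℓ) : l1Dist x x = 0 := by simp [l1Dist]

lemma l1Dist_le_of_anc_eq {ℓ i : ℕ} {x y : Grid ℓ} (h : anc i x = anc i y) :
    l1Dist x y ≤ 2 * ((2 : ℝ) ^ i)⁻¹ := by
  have hx := (point_mem_cell_iff x _).2 h
  have hy := (point_mem_cell_iff y (anc i y)).2 rfl
  obtain ⟨⟨_, _⟩, ⟨_, _⟩⟩ := hx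
  obtain ⟨⟨_, _⟩, ⟨_, _⟩⟩ := hy
  have h1 : |(point x).1 - (point y).1| ≤ ((2 : ℝ) ^ i)⁻¹ := by rw [abs_le]; constructor <;> linarith
  have h2 : |(point x).2 - (point y).2| ≤ ((2 : ℝ) ^ i)⁻¹ := by rw [abs_le]; constructor <;> linarith
  unfold l1Dist
  linarith

/-! ### The earth mover's distance is bounded by the pyramidal transform -/

/-- A plan that transports, within every level-`i` cell, as much mass of `p` to `q` as possible. -/
structure IsPartialPlan {ℓ : ℕ} (p q : Grid ℓ → ℝ) (i : ℕ) (γ : Grid ℓ → Grid ℓ → ℝ) : Prop where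
  nonneg : ∀ x y, 0 ≤ γ x y
  row_le : ∀ x, ∑ y, γ x y ≤ p x
  col_le : ∀ y, ∑ x, γ x y ≤ q y
  row_mass : ∀ c : Grid i, levelSum (fun x => ∑ y, γ x y) c = min (levelSum p c) (levelSum q c)
  col_mass : ∀ c : Grid i, levelSum (fun y => ∑ x, γ x y) c = min (levelSum p c) (levelSum q c)
  -- Mass first matched at level `j - 1` moves at most `2 * 2^{-(j-1)}` and amounts to at most half
  -- the level-`j` discrepancy; hence the sum starts at `i + 1`.
  cost_le : ∑ x, ∑ y, γ x y * l1Dist x y ≤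
    ∑ j ∈ Finset.Ico (i + 1) (ℓ + 1),
      2 * ((2 : ℝ) ^ j)⁻¹ * ∑ c : Grid j, |levelSum p c - levelSum q c|

lemma levelSum_self {ℓ : ℕ} (s : Grid ℓ → ℝ) (c : Grid ℓ) : levelSum s c = s c := by
  rw [levelSum_eq, Finset.sum_filter]
  simp [anc_self]

lemma exists_isPartialPlan_self {ℓ : ℕ} {p q : Grid ℓ → ℝ} (hp : 0 ≤ p) (hq : 0 ≤ q) :
    ∃ γ, IsPartialPlan p q ℓ γ := by
  refine ⟨fun x y => if x = y then min (p x) (q x) else 0, ?_, ?_, ?_, ?_, ?_, ?_⟩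
  · intro x y
    split_ifs
    exacts [le_min (hp x) (hq x), le_rfl]
  · intro x; simp
  · intro y; simp
  · intro c; simp [levelSum_self]
  · intro c; simp [levelSum_self]
  · simp [ite_mul, l1Dist_self]

lemma mul_div_max_eq_min {a b : ℝ} (ha : 0 ≤ a) (hb : 0 ≤ b) : a * b / max a b = min a b := by
  rcases eq_or_ne (max a b) 0 with h | h
  · have h1 : a = 0 := le_antisymm (h ▸ le_max_left a b) ha
    have h2 : b = 0 := le_antisymm (h ▸ le_max_right a b) hb
    simp [h1, h2]
  · rw [div_eq_iff h, min_mul_max]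

/-- In each cell, take the product of the two measures divided by the larger of their masses there:
it overloads neither side and has total mass the smaller one. For empty cells the convention `0 / 0
= 0` is the right value. -/
lemma sum_sum_cell_le {ℓ i : ℕ} {p' q' : Grid ℓ → ℝ} (hp' : 0 ≤ p') (hq' : 0 ≤ q') :
    ∃ δ : Grid ℓ → Grid ℓ → ℝ, (∀ x y, 0 ≤ δ x y) ∧ (∀ x, ∑ y, δ x y ≤ p' x) ∧
      (∀ y, ∑ x, δ x y ≤ q' y) ∧
      (∀ c : Grid i, levelSum (fun x => ∑ y, δ x y) c = min (levelSum p' c) (levelSum q' c)) ∧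
      (∀ c : Grid i, levelSum (fun y => ∑ x, δ x y) c = min (levelSum p' c) (levelSum q' c)) ∧
      ∑ x, ∑ y, δ x y * l1Dist x y ≤
        2 * ((2 : ℝ) ^ i)⁻¹ * ∑ c : Grid i, min (levelSum p' c) (levelSum q' c) := by
  set m : Grid i → ℝ := fun c => max (levelSum p' c) (levelSum q' c) with hm
  have hP : ∀ c : Grid i, 0 ≤ levelSum p' c := levelSum_nonneg hp'
  have hQ : ∀ c : Grid i, 0 ≤ levelSum q' c := levelSum_nonneg hq'
  have hm0 : ∀ c, 0 ≤ m c := fun c => (hP c).trans (le_max_left _ _)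
  let δ : Grid ℓ → Grid ℓ → ℝ := fun x y =>
    if anc i y = anc i x then p' x * q' y / m (anc i x) else 0
  have hδ0 : ∀ x y, 0 ≤ δ x y := by
    intro x y
    simp only [δ]
    split_ifs
    · exact div_nonneg (mul_nonneg (hp' x) (hq' y)) (hm0 _)
    · exact le_rfl
  have hrow : ∀ x, ∑ y, δ x y = p' x * (levelSum q' (anc i x) / m (anc i x)) := by
    intro x
    simp only [δ, levelSum_eq, ← Finset.sum_filter]
    rw [Finset.sum_div, Finset.mul_sum]
    exact Finset.sum_congr rfl fun y _ => by ring
  have hcol : ∀ y, ∑ x, δ x y = q' y * (levelSum p' (anc i y) / m (anc i y)) := by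
    intro y
    simp only [δ]
    rw [levelSum_eq, Finset.sum_div, Finset.mul_sum, Finset.sum_filter]
    refine Finset.sum_congr rfl fun x _ => ?_
    by_cases h : anc i x = anc i y
    · rw [if_pos h, if_pos h.symm, h]; ring
    · rw [if_neg h, if_neg (Ne.symm h)]
  have hrowm : ∀ c : Grid i,
      levelSum (fun x => ∑ y, δ x y) c = min (levelSum p' c) (levelSum q' c) := by
    intro c
    rw [← mul_div_max_eq_min (hP c) (hQ c), mul_div_assoc]
    change _ = levelSum p' c * (levelSum q' c / m c)
    rw [levelSum_eq, levelSum_eq p', Finset.sum_mul]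
    refine Finset.sum_congr rfl fun x hx => ?_
    rw [hrow, (Finset.mem_filter.1 hx).2]
  refine ⟨δ, hδ0, ?_, ?_, hrowm, ?_, ?_⟩
  · intro x
    rw [hrow]
    exact mul_le_of_le_one_right (hp' x) (div_le_one_of_le₀ (le_max_right _ _) (hm0 _))
  · intro x
    rw [hcol]
    exact mul_le_of_le_one_right (hq' x) (div_le_one_of_le₀ (le_max_left _ _) (hm0 _))
  · intro c
    rw [← mul_div_max_eq_min (hP c) (hQ c), mul_comm (levelSum p' c), mul_div_assoc]
    change _ = levelSum q' c * (levelSum p' c / m c)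
    rw [levelSum_eq, levelSum_eq q', Finset.sum_mul]
    refine Finset.sum_congr rfl fun x hx => ?_
    rw [hcol, (Finset.mem_filter.1 hx).2]
  · simp only [← hrowm]
    rw [sum_levelSum, Finset.mul_sum]
    refine Finset.sum_le_sum fun x _ => ?_
    rw [Finset.mul_sum]
    refine Finset.sum_le_sum fun y _ => ?_
    by_cases h : anc i y = anc i x
    · rw [mul_comm]
      exact mul_le_mul_of_nonneg_right (l1Dist_le_of_anc_eq h.symm) (hδ0 _ _)
    · simp [δ, h]

/-- The masses left over by the finer plan are matched inside the coarser cells. -/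
lemma IsPartialPlan.exists_pred {ℓ i : ℕ} (hi : i < ℓ) {p q : Grid ℓ → ℝ}
    {γ : Grid ℓ → Grid ℓ → ℝ} (hγ : IsPartialPlan p q (i + 1) γ) :
    ∃ γ', IsPartialPlan p q i γ' := by
  set p' : Grid ℓ → ℝ := p - fun x => ∑ y, γ x y with hp'
  set q' : Grid ℓ → ℝ := q - fun y => ∑ x, γ x y with hq'
  have hp0 : 0 ≤ p' := fun x => sub_nonneg.2 (hγ.row_le x)
  have hq0 : 0 ≤ q' := fun x => sub_nonneg.2 (hγ.col_le x)
  obtain ⟨δ, hδ0, hδr, hδc, hδrm, hδcm, hδcost⟩ := sum_sum_cell_le (i := i) hp0 hq0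
  have hg : ∀ c : Grid i, levelSum (fun x => ∑ y, γ x y) c = levelSum (fun y => ∑ x, γ x y) c := by
    intro c
    rw [levelSum_eq_sum_children (Nat.le_succ i), levelSum_eq_sum_children (Nat.le_succ i)]
    exact Finset.sum_congr rfl fun d _ => by rw [hγ.row_mass, hγ.col_mass]
  refine ⟨fun x y => γ x y + δ x y, ?_, ?_, ?_, ?_, ?_, ?_⟩
  · exact fun x y => add_nonneg (hγ.nonneg x y) (hδ0 x y)
  · intro x
    have := hδr x
    simp only [hp', Pi.sub_apply] at this
    rw [Finset.sum_add_distrib]; linarith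
  · intro x
    have := hδc x
    simp only [hq', Pi.sub_apply] at this
    rw [Finset.sum_add_distrib]; linarith
  · intro c
    simp only [Finset.sum_add_distrib]
    have h1 := levelSum_add (fun x => ∑ y, γ x y) (fun x => ∑ y, δ x y) c
    simp only [Pi.add_def] at h1
    rw [h1, hδrm, hp', hq', levelSum_sub, levelSum_sub, hg, min_sub_sub_right]
    ring
  · intro c
    simp only [Finset.sum_add_distrib]
    have h1 := levelSum_add (fun y => ∑ x, γ x y) (fun y => ∑ x, δ x y) c
    simp only [Pi.add_def] at h1
    rw [h1, hδcm, hp', hq', levelSum_sub, levelSum_sub, hg, min_sub_sub_right]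
    ring
  · simp only [add_mul, Finset.sum_add_distrib]
    rw [Finset.sum_eq_sum_Ico_succ_bot (by omega), add_comm]
    refine add_le_add (hδcost.trans ?_) hγ.cost_le
    have h2 : ∑ c : Grid i, min (levelSum p' c) (levelSum q' c) ≤
        1 / 2 * ∑ d : Grid (i + 1), |levelSum p d - levelSum q d| := by
      rw [← Finset.sum_fiberwise Finset.univ (anc i) (fun d : Grid (i + 1) => _), Finset.mul_sum]
      refine Finset.sum_le_sum fun c _ => ?_
      -- In every child cell the finer plan has exhausted one side, so what remains is exactly the
      -- absolute discrepancy. The matched minimum is at most half the sum of the two remainders.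
      have h3 : levelSum p' c + levelSum q' c =
          ∑ d : Grid (i + 1) with anc i d = c, |levelSum p d - levelSum q d| := by
        rw [levelSum_eq_sum_children (Nat.le_succ i), levelSum_eq_sum_children (Nat.le_succ i),
          ← Finset.sum_add_distrib]
        refine Finset.sum_congr rfl fun d _ => ?_
        rw [hp', hq', levelSum_sub, levelSum_sub, hγ.row_mass, hγ.col_mass]
        rcases le_total (levelSum p d) (levelSum q d) with h | h
        · rw [min_eq_left h, abs_of_nonpos (by linarith)]; ring
        · rw [min_eq_right h, abs_of_nonneg (by linarith)]; ring
      rw [← h3]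
      have := min_le_left (levelSum p' c) (levelSum q' c)
      have := min_le_right (levelSum p' c) (levelSum q' c)
      linarith
    calc 2 * ((2 : ℝ) ^ i)⁻¹ * ∑ c : Grid i, min (levelSum p' c) (levelSum q' c)
        ≤ 2 * ((2 : ℝ) ^ i)⁻¹ * (1 / 2 * ∑ d : Grid (i + 1), |levelSum p d - levelSum q d|) :=
          mul_le_mul_of_nonneg_left h2 (by positivity)
      _ = _ := by
        have h4 : ((2 : ℝ) ^ (i + 1))⁻¹ = ((2 : ℝ) ^ i)⁻¹ * (1 / 2) := by rw [pow_succ]; ring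
        rw [h4]; ring

lemma exists_isPartialPlan {ℓ i : ℕ} (hi : i ≤ ℓ) {p q : Grid ℓ → ℝ} (hp : 0 ≤ p) (hq : 0 ≤ q) :
    ∃ γ, IsPartialPlan p q i γ :=
  Nat.decreasingInduction (motive := fun i _ => ∃ γ, IsPartialPlan p q i γ)
    (fun _ hk ⟨_, hγ⟩ => hγ.exists_pred hk) (exists_isPartialPlan_self hp hq) hi

lemma bddBelow_cost {ℓ : ℕ} (p q : Grid ℓ → ℝ) :
    BddBelow ((fun γ : Grid ℓ → Grid ℓ → ℝ => ∑ x, ∑ y, γ x y * l1Dist x y) '' couplings p q) := by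
  refine ⟨0, ?_⟩
  rintro _ ⟨γ, hγ, rfl⟩
  exact Finset.sum_nonneg fun x _ => Finset.sum_nonneg fun y _ =>
    mul_nonneg (hγ.1 x y) (l1Dist_nonneg x y)

/-- At level 0 all mass is matched; marginals dominated by `p` and `q` with the same totals are
equal to them, so the plan is a coupling. -/
theorem emd_le_sum_abs_pyramid {ℓ : ℕ} {p q : Grid ℓ → ℝ} (hp : 0 ≤ p) (hq : 0 ≤ q)
    (hpq : ∑ x, p x = ∑ x, q x) : emd p q ≤ 2 * ∑ c, |pyramid p c - pyramid q c| := by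
  obtain ⟨γ, hγ⟩ := exists_isPartialPlan (Nat.zero_le ℓ) hp hq
  have hlev : ∀ (s : Grid ℓ → ℝ) (c : Grid 0), levelSum s c = ∑ x, s x := by
    intro s c
    have : Subsingleton (Grid 0) := inferInstanceAs (Subsingleton (Fin 1 × Fin 1))
    rw [← sum_levelSum 0 s, Fintype.sum_eq_single c fun d hd => absurd (Subsingleton.elim d c) hd]
  have hr := hγ.row_mass (0, 0)
  have hc := hγ.col_mass (0, 0)
  simp only [hlev, hpq, min_self] at hr hc
  rw [← hpq] at hr
  have hγc : γ ∈ couplings p q := by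
    refine ⟨hγ.nonneg, fun x => ?_, fun y => ?_⟩
    · exact (Finset.sum_eq_sum_iff_of_le fun x _ => hγ.row_le x).1 hr x (Finset.mem_univ x)
    · exact (Finset.sum_eq_sum_iff_of_le fun x _ => hγ.col_le x).1 hc y (Finset.mem_univ y)
  refine (csInf_le (bddBelow_cost p q) ⟨γ, hγc, rfl⟩).trans (hγ.cost_le.trans ?_)
  rw [Fintype.sum_sigma, Finset.mul_sum]
  simp only [pyramid]
  rw [Fin.sum_univ_eq_sum_range (fun i => 2 * ∑ c : Grid i, |((2 : ℝ) ^ i)⁻¹ * levelSum p c -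
      ((2 : ℝ) ^ i)⁻¹ * levelSum q c|) (ℓ + 1)]
  refine (Finset.sum_le_sum fun j _ => le_of_eq ?_).trans
    (Finset.sum_le_sum_of_subset_of_nonneg (fun j hj => ?_) fun j _ _ => by positivity)
  · rw [mul_assoc, Finset.mul_sum]
    refine congrArg _ (Finset.sum_congr rfl fun c _ => ?_)
    rw [← mul_sub, abs_mul, abs_of_nonneg (a := ((2 : ℝ) ^ j)⁻¹) (by positivity)]
  · simp only [Finset.mem_Ico, Finset.mem_range] at hj ⊢
    omega

/-! ### Cells near a sparse set of points -/

open Classical in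
/-- The level-`i` cells whose index is at distance at most `r` from that of a cell meeting `T`. -/
def near {ℓ : ℕ} (r : ℕ) (T : Finset (Grid ℓ)) (i : ℕ) : Finset (Grid i) :=
  T.biUnion fun t => Finset.univ.filter fun c =>
    ((c.1 : ℕ) ≤ (anc i t).1 + r ∧ ((anc i t).1 : ℕ) ≤ c.1 + r) ∧
      ((c.2 : ℕ) ≤ (anc i t).2 + r ∧ ((anc i t).2 : ℕ) ≤ c.2 + r)

lemma mem_near {ℓ r i : ℕ} {T : Finset (Grid ℓ)} {c : Grid i} :
    c ∈ near r T i ↔ ∃ t ∈ T, ((c.1 : ℕ) ≤ (anc i t).1 + r ∧ ((anc i t).1 : ℕ) ≤ c.1 + r) ∧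
      ((c.2 : ℕ) ≤ (anc i t).2 + r ∧ ((anc i t).2 : ℕ) ≤ c.2 + r) := by
  simp [near]

lemma card_near_le {ℓ : ℕ} (r : ℕ) (T : Finset (Grid ℓ)) (i : ℕ) :
    (near r T i).card ≤ T.card * (2 * r + 1) ^ 2 := by
  refine Finset.card_biUnion_le_card_mul _ _ _ fun t _ => ?_
  have : ((Finset.range (2 * r + 1)) ×ˢ (Finset.range (2 * r + 1))).card = (2 * r + 1) ^ 2 := by
    simp [sq]
  rw [← this]
  refine Finset.card_le_card_of_injOn
    -- The index offset shifted by `r`; the subtraction does not truncate on the filtered cells.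
    (fun c : Grid i => (c.1 + r - (anc i t).1, c.2 + r - (anc i t).2)) ?_ ?_
  · intro c hc
    simp only [Finset.coe_filter, Finset.mem_univ, true_and, Set.mem_ofPred_eq] at hc
    simp only [Finset.coe_product, Finset.coe_range, Set.mem_prod, Set.mem_Iio]
    omega
  · intro c hc c' hc' h
    simp only [Finset.coe_filter, Finset.mem_univ, true_and, Set.mem_ofPred_eq] at hc hc'
    simp only [Prod.mk.injEq] at h
    refine Prod.ext (Fin.ext ?_) (Fin.ext ?_) <;> omega

lemma anc_pred_fst {i : ℕ} (c : Grid (i + 1)) : ((anc i c).1 : ℕ) = c.1 / 2 := by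
  have h (a : ℕ) : a * 2 ^ i / 2 ^ (i + 1) = a / 2 := by
    rw [pow_succ', Nat.mul_div_mul_right _ _ (by positivity)]
  exact h _

lemma anc_pred_snd {i : ℕ} (c : Grid (i + 1)) : ((anc i c).2 : ℕ) = c.2 / 2 := by
  have h (a : ℕ) : a * 2 ^ i / 2 ^ (i + 1) = a / 2 := by
    rw [pow_succ', Nat.mul_div_mul_right _ _ (by positivity)]
  exact h _

/-- Halving two indices at distance at most `r` leaves them at distance at most `(r + 1) / 2 ≤ r`.
This makes `near r T` a tree, as the comparison with the greedy search requires. -/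
lemma anc_mem_near {ℓ r i : ℕ} (hr : 1 ≤ r) {T : Finset (Grid ℓ)} {c : Grid (i + 1)}
    (hc : c ∈ near r T (i + 1)) : anc i c ∈ near r T i := by
  obtain ⟨t, ht, h⟩ := mem_near.1 hc
  refine mem_near.2 ⟨t, ht, ?_⟩
  rw [← anc_anc (show i ≤ i + 1 by omega) t]
  simp only [anc_pred_fst, anc_pred_snd]
  omega

/-- An index gap larger than `r` leaves at least `r` full cells in between. -/
lemma le_l1Dist_of_notMem_near {ℓ r i : ℕ} {T : Finset (Grid ℓ)} {x t : Grid ℓ} (ht : t ∈ T)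
    (hx : anc i x ∉ near r T i) : r * ((2 : ℝ) ^ i)⁻¹ ≤ l1Dist t x := by
  have key : ∀ (c a : ℕ) (u v : ℝ),
      u ∈ Set.Ico ((c : ℝ) / 2 ^ i) ((c : ℝ) / 2 ^ i + ((2 : ℝ) ^ i)⁻¹) →
      v ∈ Set.Ico ((a : ℝ) / 2 ^ i) ((a : ℝ) / 2 ^ i + ((2 : ℝ) ^ i)⁻¹) → a + r < c →
      r * ((2 : ℝ) ^ i)⁻¹ ≤ u - v := by
    intro c a u v hu hv h
    have h1 : (a : ℝ) + r + 1 ≤ c := by exact_mod_cast h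
    have h2 := mul_le_mul_of_nonneg_right h1 (show (0 : ℝ) ≤ ((2 : ℝ) ^ i)⁻¹ by positivity)
    have h3 := hu.1
    have h4 := hv.2
    rw [div_eq_mul_inv] at h3 h4
    linarith
  have h1 := (point_mem_cell_iff x (anc i x)).2 rfl
  have h2 := (point_mem_cell_iff t (anc i t)).2 rfl
  have habs1 := le_abs_self ((point t).1 - (point x).1)
  have habs2 := le_abs_self ((point t).2 - (point x).2)
  have habs3 := neg_abs_le ((point t).1 - (point x).1)
  have habs4 := neg_abs_le ((point t).2 - (point x).2)
  have hnn1 := abs_nonneg ((point t).1 - (point x).1)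
  have hnn2 := abs_nonneg ((point t).2 - (point x).2)
  have h3 : ¬ _ := fun h => hx (mem_near.2 ⟨t, ht, h⟩)
  unfold l1Dist
  simp only [not_and_or, not_le] at h3
  rcases h3 with (h3 | h3) | (h3 | h3)
  · linarith [key _ _ _ _ h1.1 h2.1 h3]
  · linarith [key _ _ _ _ h2.1 h1.1 h3]
  · linarith [key _ _ _ _ h1.2 h2.2 h3]
  · linarith [key _ _ _ _ h2.2 h1.2 h3]

/-- The exponents are distinct, so the sum is at most twice its largest term, the one with the least
exponent. -/
lemma sum_inv_two_pow_le_of_forall_le (A : Finset ℕ) {D : ℝ} (hD : 0 ≤ D)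
    (h : ∀ i ∈ A, ((2 : ℝ) ^ i)⁻¹ ≤ D) : ∑ i ∈ A, ((2 : ℝ) ^ i)⁻¹ ≤ 2 * D := by
  rcases A.eq_empty_or_nonempty with rfl | hA
  · simpa using hD
  set m := A.min' hA
  have hs : Summable fun n : ℕ => ((2 : ℝ) ^ (m + n))⁻¹ := by
    simpa [pow_add, mul_comm] using
      (summable_geometric_two.mul_left ((2 : ℝ) ^ m)⁻¹)
  calc ∑ i ∈ A, ((2 : ℝ) ^ i)⁻¹
      = ∑ i ∈ A.image (fun i => i - m), ((2 : ℝ) ^ (m + i))⁻¹ := by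
        rw [Finset.sum_image]
        · exact Finset.sum_congr rfl fun i hi => by rw [Nat.add_sub_cancel' (A.min'_le i hi)]
        · intro i hi j hj hij
          have := A.min'_le i hi
          have := A.min'_le j hj
          change i - m = j - m at hij
          omega
    _ ≤ ∑' n : ℕ, ((2 : ℝ) ^ (m + n))⁻¹ := hs.sum_le_tsum _ fun _ _ => by positivity
    _ = 2 * ((2 : ℝ) ^ m)⁻¹ := by
        simp only [pow_add, mul_inv, tsum_mul_left]
        have := tsum_geometric_two
        simp only [one_div, inv_pow] at this
        rw [this, mul_comm]
    _ ≤ 2 * D := by linarith [h m (A.min'_mem hA)]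

-- Split `a` along the coupling: mass sent from `t ∈ T` to `x` counts at level `i` only if `r *
-- 2^{-i} ≤ l1Dist t x`, and these weights sum to at most `2 / r * l1Dist t x`.
open Classical in
lemma sum_pyramid_far_le {ℓ r : ℕ} (hr : 1 ≤ r) (T : Finset (Grid ℓ)) {a' a : Grid ℓ → ℝ}
    (hT : ∀ x ∉ T, a' x = 0) {γ : Grid ℓ → Grid ℓ → ℝ} (hγ : γ ∈ couplings a' a) :
    ∑ c : Cell ℓ with c.2 ∉ near r T c.1, pyramid a c ≤
      2 / r * ∑ x, ∑ y, γ x y * l1Dist x y := by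
  obtain ⟨hγ0, hγr, hγc⟩ := hγ
  have hr0 : (0 : ℝ) < r := by exact_mod_cast hr
  have h1 : ∀ t ∈ T, ∀ x, ∑ i : Fin (ℓ + 1),
      (if anc i x ∉ near r T i then ((2 : ℝ) ^ (i : ℕ))⁻¹ else 0) ≤ 2 / r * l1Dist t x := by
    intro t ht x
    rw [Fin.sum_univ_eq_sum_range
      (fun i => if anc i x ∉ near r T i then ((2 : ℝ) ^ (i : ℕ))⁻¹ else 0), ← Finset.sum_filter]
    refine (sum_inv_two_pow_le_of_forall_le (D := l1Dist t x / r) _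
      (div_nonneg (l1Dist_nonneg _ _) hr0.le) ?_).trans (le_of_eq (by ring))
    intro i hi
    rw [le_div_iff₀ hr0, mul_comm]
    exact le_l1Dist_of_notMem_near ht (Finset.mem_filter.1 hi).2
  have h2 : ∀ t x, γ t x * ∑ i : Fin (ℓ + 1),
      (if anc i x ∉ near r T i then ((2 : ℝ) ^ (i : ℕ))⁻¹ else 0) ≤
        γ t x * (2 / r * l1Dist t x) := by
    intro t x
    by_cases ht : t ∈ T
    · exact mul_le_mul_of_nonneg_left (h1 t ht x) (hγ0 t x)
    · have h3 : γ t x = 0 := by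
        have h4 := hγr t
        rw [hT t ht, Finset.sum_eq_zero_iff_of_nonneg fun y _ => hγ0 t y] at h4
        exact h4 x (Finset.mem_univ x)
      simp [h3]
  calc ∑ c : Cell ℓ with c.2 ∉ near r T c.1, pyramid a c
      = ∑ i : Fin (ℓ + 1), ∑ x,
          a x * (if anc i x ∉ near r T i then ((2 : ℝ) ^ (i : ℕ))⁻¹ else 0) := by
        rw [Finset.sum_filter, Fintype.sum_sigma]
        refine Finset.sum_congr rfl fun i _ => ?_
        simp only [pyramid]
        rw [← Finset.sum_filter, ← Finset.mul_sum,
          sum_levelSum_filter (i : ℕ) a (fun c => c ∉ near r T i), Finset.mul_sum,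
          Finset.sum_filter]
        refine Finset.sum_congr rfl fun x _ => ?_
        split_ifs <;> ring
    _ = ∑ x, ∑ t, γ t x * ∑ i : Fin (ℓ + 1),
          (if anc i x ∉ near r T i then ((2 : ℝ) ^ (i : ℕ))⁻¹ else 0) := by
        rw [Finset.sum_comm]
        refine Finset.sum_congr rfl fun x _ => ?_
        rw [← Finset.mul_sum, ← Finset.sum_mul, hγc]
    _ ≤ ∑ x, ∑ t, γ t x * (2 / r * l1Dist t x) :=
        Finset.sum_le_sum fun x _ => Finset.sum_le_sum fun t _ => h2 t x
    _ = _ := by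
        rw [Finset.sum_comm, Finset.mul_sum]
        refine Finset.sum_congr rfl fun x _ => ?_
        rw [Finset.mul_sum]
        exact Finset.sum_congr rfl fun y _ => by ring

/-! ### The greedy tree search -/

lemma sum_le_sum_of_card_le {α : Type*} {A B : Finset α} {f g : α → ℝ} (hcard : A.card ≤ B.card)
    (hfg : ∀ a ∈ A, ∀ b ∈ B, f a ≤ g b) (hg : ∀ b ∈ B, 0 ≤ g b) :
    ∑ a ∈ A, f a ≤ ∑ b ∈ B, g b := by
  obtain ⟨B', hB', hc⟩ := Finset.exists_subset_card_eq hcard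
  refine le_trans ?_ (Finset.sum_le_sum_of_subset_of_nonneg hB' fun b hb _ => hg b hb)
  rcases B'.eq_empty_or_nonempty with rfl | hne
  · rw [Finset.card_empty, eq_comm, Finset.card_eq_zero] at hc
    simp [hc]
  · calc ∑ a ∈ A, f a ≤ A.card • B'.inf' hne g := Finset.sum_le_card_nsmul _ _ _ fun a ha =>
          Finset.le_inf' _ _ fun b hb => hfg a ha b (hB' hb)
      _ = B'.card • B'.inf' hne g := by rw [hc]
      _ ≤ _ := Finset.card_nsmul_le_sum _ _ _ fun b hb => Finset.inf'_le _ hb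

/-- Exchange argument. If a candidate is dropped, then `S` has the full size `w ≥ W.card`, so there
are at least as many cells in `S \ W` as dropped ones, all with larger measurements. The two
families are disjoint, so each noise term is paid once. -/
lemma sum_dropped_le {α : Type*} [DecidableEq α] {w : ℕ} {T S W : Finset α} {y z : α → ℝ}
    (hST : S ⊆ T) (hS : S.card = min w T.card) (hW : W.card ≤ w)
    (hmax : ∀ p ∈ S, ∀ q ∈ T, q ∉ S → y q ≤ y p) (hz : ∀ c, 0 ≤ z c) :
    ∑ c ∈ (W ∩ T) \ S, z c ≤ ∑ c ∈ S \ W, z c + ∑ c ∈ T, |y c - z c| := by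
  set A := (W ∩ T) \ S
  rcases A.eq_empty_or_nonempty with hA | ⟨c₀, hc₀⟩
  · rw [hA, Finset.sum_empty]
    exact add_nonneg (Finset.sum_nonneg fun c _ => hz c) (Finset.sum_nonneg fun c _ => abs_nonneg _)
  have hlt : S.card < T.card := Finset.card_lt_card ⟨hST, fun h =>
    (Finset.mem_sdiff.1 hc₀).2 (h (Finset.mem_inter.1 (Finset.mem_sdiff.1 hc₀).1).2)⟩
  have hcard : A.card ≤ (S \ W).card := by
    have h1 : A.card ≤ (W \ S).card := Finset.card_le_card
      (Finset.sdiff_subset_sdiff Finset.inter_subset_left le_rfl)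
    have h2 := Finset.card_sdiff_add_card_inter W S
    have h3 := Finset.card_sdiff_add_card_inter S W
    rw [Finset.inter_comm] at h3
    omega
  have h4 : ∑ a ∈ A, (z a - |y a - z a|) ≤ ∑ b ∈ S \ W, (z b + |y b - z b|) := by
    refine sum_le_sum_of_card_le hcard (fun a ha b hb => ?_)
      fun b _ => add_nonneg (hz b) (abs_nonneg _)
    have ha' := Finset.mem_sdiff.1 ha
    have := hmax b (Finset.mem_sdiff.1 hb).1 a (Finset.mem_inter.1 ha'.1).2 ha'.2
    linarith [neg_abs_le (y a - z a), le_abs_self (y b - z b)]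
  rw [Finset.sum_sub_distrib, Finset.sum_add_distrib] at h4
  have hdisj : Disjoint A (S \ W) := Finset.disjoint_left.2 fun a ha hb =>
    (Finset.mem_sdiff.1 ha).2 (Finset.mem_sdiff.1 hb).1
  have h5 : ∑ c ∈ A ∪ S \ W, |y c - z c| ≤ ∑ c ∈ T, |y c - z c| := by
    refine Finset.sum_le_sum_of_subset_of_nonneg (Finset.union_subset ?_ ?_)
      fun _ _ _ => abs_nonneg _
    · exact Finset.sdiff_subset.trans Finset.inter_subset_right
    · exact Finset.sdiff_subset.trans hST
  rw [Finset.sum_union hdisj] at h5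
  linarith

lemma sum_range_le_of_contracting {m e : ℕ → ℝ} (h0 : m 0 ≤ e 0) (n : ℕ) (hm : ∀ i, 0 ≤ m i)
    (h : ∀ i < n, m (i + 1) ≤ e (i + 1) + 1 / 2 * m i) :
    ∑ i ∈ Finset.range (n + 1), m i ≤ 2 * ∑ i ∈ Finset.range (n + 1), e i := by
  -- The extra `m n` pays for the term `1 / 2 * m n` of the next step, which is counted twice.
  suffices ∑ i ∈ Finset.range (n + 1), m i + m n ≤ 2 * ∑ i ∈ Finset.range (n + 1), e i by
    linarith [hm n]
  induction n with
  | zero => simp; linarith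
  | succ n ih =>
    have h1 := ih fun i hi => h i (by omega)
    have h2 := h n (by omega)
    rw [Finset.sum_range_succ, Finset.sum_range_succ _ (n + 1)]
    linarith

/-- The candidate cells among which the greedy search chooses at each level. -/
noncomputable def candidates (S : ∀ i : ℕ, Finset (Grid i)) : ∀ i : ℕ, Finset (Grid i)
  | 0 => Finset.univ
  | i + 1 => children (S i)

lemma IsGreedyTree.subset_candidates {ℓ w : ℕ} {y : Cell ℓ → ℝ} {S : ∀ i : ℕ, Finset (Grid i)}
    (hS : IsGreedyTree w y S) : ∀ i < ℓ + 1, S i ⊆ candidates S i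
  | 0, _ => Finset.subset_univ _
  | _ + 1, hi => (hS.2 _ hi).1

lemma sum_cell_eq_sum_range {ℓ : ℕ} (f : ∀ i : ℕ, Grid i → ℝ) :
    ∑ c : Cell ℓ, f c.1 c.2 = ∑ i ∈ Finset.range (ℓ + 1), ∑ c : Grid i, f i c := by
  rw [Fintype.sum_sigma, Fin.sum_univ_eq_sum_range (fun i => ∑ c : Grid i, f i c)]

-- A missed cell of `W` either was a candidate and got dropped (`sum_dropped_le`), or its parent is
-- already a missed cell of `W`. The second kind contributes at most half of the previous level's
-- loss.
open Classical in
lemma sum_pyramid_missed_le {ℓ w : ℕ} {s : Grid ℓ → ℝ} (hs : 0 ≤ s) {y : Cell ℓ → ℝ}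
    {S W : ∀ i : ℕ, Finset (Grid i)} (hS : IsGreedyTree w y S) (hWcard : ∀ i, (W i).card ≤ w)
    (hWtree : ∀ i, ∀ c ∈ W (i + 1), anc i c ∈ W i) :
    ∑ c : Cell ℓ with c.2 ∈ W c.1 \ S c.1, pyramid s c ≤
      2 * (∑ c : Cell ℓ with c.2 ∈ S c.1 \ W c.1, pyramid s c +
        ∑ c : Cell ℓ with c.2 ∈ candidates S c.1, |y c - pyramid s c|) := by
  let z : ∀ i : ℕ, Grid i → ℝ := fun i c => ((2 : ℝ) ^ i)⁻¹ * levelSum s c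
  -- Extended by `0` beyond level `ℓ`, so that levels can be indexed by `ℕ`.
  let y' : ∀ i : ℕ, Grid i → ℝ := fun i c => if h : i < ℓ + 1 then y ⟨⟨i, h⟩, c⟩ else 0
  have hz : ∀ i (c : Grid i), 0 ≤ z i c := fun i c =>
    mul_nonneg (by positivity) (levelSum_nonneg hs c)
  have hy' : ∀ c : Cell ℓ, y c = y' c.1 c.2 := fun c => by
    simp only [y', dif_pos c.1.2]
  have key := sum_range_le_of_contracting
    (m := fun i => ∑ c ∈ W i \ S i, z i c)
    (e := fun i => ∑ c ∈ S i \ W i, z i c + ∑ c ∈ candidates S i, |y' i c - z i c|) ?_ ℓ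
    (fun i => Finset.sum_nonneg fun c _ => hz i c) ?_
  · have h1 := sum_cell_eq_sum_range (ℓ := ℓ) (fun i c => if c ∈ W i \ S i then z i c else 0)
    have h2 := sum_cell_eq_sum_range (ℓ := ℓ) (fun i c => if c ∈ S i \ W i then z i c else 0)
    have h3 := sum_cell_eq_sum_range (ℓ := ℓ)
      (fun i c => if c ∈ candidates S i then |y' i c - z i c| else 0)
    simp only [Finset.sum_ite_mem, Finset.univ_inter] at h1 h2 h3
    rw [Finset.sum_filter, Finset.sum_filter, Finset.sum_filter]
    simp only [hy']
    refine (h1.trans_le key).trans (le_of_eq ?_)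
    rw [Finset.sum_add_distrib, ← h2, ← h3]
    rfl
  · have : W 0 \ S 0 = ∅ := by rw [hS.1]; simp
    simp only [this, Finset.sum_empty]
    exact add_nonneg (Finset.sum_nonneg fun c _ => hz 0 c)
      (Finset.sum_nonneg fun c _ => abs_nonneg _)
  · intro i hi
    obtain ⟨hsub, hcard, hmax⟩ := hS.2 i (by omega)
    have h1 := sum_dropped_le (y := y' (i + 1)) (z := z (i + 1)) hsub hcard (hWcard (i + 1))
      (fun p hp q hq hqS => by
        simp only [y', dif_pos (show i + 1 < ℓ + 1 by omega)]
        exact hmax p hp q hq hqS) (hz (i + 1))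
    have h2 : ∑ c ∈ (W (i + 1) \ S (i + 1)) \ children (S i), z (i + 1) c ≤
        1 / 2 * ∑ c ∈ W i \ S i, z i c := by
      have h3 : ∀ c ∈ W i \ S i,
          1 / 2 * z i c = ∑ d : Grid (i + 1) with anc i d = c, z (i + 1) d := by
        intro c _
        simp only [z]
        rw [levelSum_eq_sum_children (Nat.le_succ i), ← Finset.mul_sum]
        have h4 : ((2 : ℝ) ^ (i + 1))⁻¹ = 1 / 2 * ((2 : ℝ) ^ i)⁻¹ := by rw [pow_succ]; ring
        rw [h4, mul_assoc]
      rw [Finset.mul_sum, Finset.sum_congr rfl h3, ← Finset.sum_biUnion]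
      · refine Finset.sum_le_sum_of_subset_of_nonneg (fun d hd => ?_) fun d _ _ => hz _ d
        simp only [Finset.mem_sdiff, mem_children] at hd
        simp only [Finset.mem_biUnion, Finset.mem_filter, Finset.mem_univ, true_and,
          exists_eq_right', Finset.mem_sdiff]
        exact ⟨hWtree i d hd.1.1, hd.2⟩
      · intro c _ c' _ hcc
        refine Finset.disjoint_left.2 fun d hd hd' => hcc ?_
        rw [← (Finset.mem_filter.1 hd).2, ← (Finset.mem_filter.1 hd').2]
    have h5 : W (i + 1) \ S (i + 1) =
        ((W (i + 1) ∩ children (S i)) \ S (i + 1)) ∪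
          ((W (i + 1) \ S (i + 1)) \ children (S i)) := by
      ext d
      simp only [Finset.mem_union, Finset.mem_sdiff, Finset.mem_inter]
      tauto
    have h6 : ∑ c ∈ W (i + 1) \ S (i + 1), z (i + 1) c ≤
        ∑ c ∈ (W (i + 1) ∩ children (S i)) \ S (i + 1), z (i + 1) c +
          ∑ c ∈ (W (i + 1) \ S (i + 1)) \ children (S i), z (i + 1) c := by
      conv_lhs => rw [h5]
      rw [← Finset.sum_union_inter]
      linarith [Finset.sum_nonneg (s := ((W (i + 1) ∩ children (S i)) \ S (i + 1)) ∩
        ((W (i + 1) \ S (i + 1)) \ children (S i))) fun c _ => hz (i + 1) c]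
    simp only [candidates]
    linarith

-- Cells in `S` contribute noise, cells in `W \ S` are missed, and all others lie outside `W`.
-- Bounding the missed part gives `1 + 2 = 3` for both coefficients.
open Classical in
lemma sum_abs_restrictTo_sub_pyramid_le {ℓ w : ℕ} {s : Grid ℓ → ℝ} (hs : 0 ≤ s) {y : Cell ℓ → ℝ}
    {S W : ∀ i : ℕ, Finset (Grid i)} (hS : IsGreedyTree w y S) (hWcard : ∀ i, (W i).card ≤ w)
    (hWtree : ∀ i, ∀ c ∈ W (i + 1), anc i c ∈ W i) :
    ∑ c, |restrictTo y S c - pyramid s c| ≤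
      3 * ∑ c : Cell ℓ with c.2 ∉ W c.1, pyramid s c +
        3 * ∑ c : Cell ℓ with c.2 ∈ candidates S c.1, |y c - pyramid s c| := by
  have h1 := sum_pyramid_missed_le hs hS hWcard hWtree
  have h2 : ∑ c : Cell ℓ with c.2 ∈ S c.1 \ W c.1, pyramid s c ≤
      ∑ c : Cell ℓ with c.2 ∉ W c.1, pyramid s c :=
    Finset.sum_le_sum_of_subset_of_nonneg (fun c hc => by simp at hc ⊢; exact hc.2)
      fun c _ _ => pyramid_nonneg hs c
  have h3 : ∑ c, |restrictTo y S c - pyramid s c| ≤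
      ∑ c : Cell ℓ with c.2 ∉ W c.1, pyramid s c +
        ∑ c : Cell ℓ with c.2 ∈ W c.1 \ S c.1, pyramid s c +
        ∑ c : Cell ℓ with c.2 ∈ candidates S c.1, |y c - pyramid s c| := by
    simp only [Finset.sum_filter]
    rw [← Finset.sum_add_distrib, ← Finset.sum_add_distrib]
    refine Finset.sum_le_sum fun c _ => ?_
    have hp := pyramid_nonneg hs c
    have ha := abs_nonneg (y c - pyramid s c)
    by_cases hcS : c.2 ∈ S c.1
    · have := hS.subset_candidates c.1 c.1.2 hcS
      simp only [restrictTo, hcS, this, if_true, Finset.mem_sdiff]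
      split_ifs <;> linarith
    · simp only [restrictTo, hcS, if_false, zero_sub, abs_neg, abs_of_nonneg hp,
        Finset.mem_sdiff, not_false_eq_true, and_true]
      split_ifs <;> linarith
  linarith

/-! ### Reconstruction error -/

/-- The true `s` is a competitor in the minimization; then the triangle inequality. -/
lemma IsLPSolution.sum_abs_pyramid_sub_le {ℓ : ℕ} {z : Cell ℓ → ℝ} {t s : Grid ℓ → ℝ}
    (ht : IsLPSolution z t) (hs : 0 ≤ s) :
    ∑ c, |pyramid t c - pyramid s c| ≤ 2 * ∑ c, |z c - pyramid s c| := by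
  have h1 := ht.2 s hs
  have h2 : ∑ c, |pyramid t c - pyramid s c| ≤
      ∑ c, |z c - pyramid t c| + ∑ c, |z c - pyramid s c| := by
    rw [← Finset.sum_add_distrib]
    refine Finset.sum_le_sum fun c _ => ?_
    rw [abs_sub_comm (z c) (pyramid t c)]
    exact abs_sub_le _ _ _
  linarith

/-- The root coordinate of the pyramid is the total mass, so the mass error is at most `E` and
dividing by the wrong mass costs only `O(E / n)`. If `t = 0`, then `n ≤ E` and the trivial bound is
good enough. -/
lemma emd_normalize_le {ℓ : ℕ} {t a : Grid ℓ → ℝ} (ht : 0 ≤ t) (ha : a ∈ stdSimplex ℝ (Grid ℓ))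
    {n : ℝ} (hn : 0 < n) :
    emd (normalize t : Grid ℓ → ℝ) a ≤ 8 / n * ∑ c, |pyramid t c - pyramid (n • a) c| := by
  set E := ∑ c, |pyramid t c - pyramid (n • a) c| with hE
  have hb : (normalize t : Grid ℓ → ℝ) ∈ stdSimplex ℝ (Grid ℓ) := (normalize t).2
  have hm : |∑ x, t x - n| ≤ E := by
    have := abs_sum_le_sum_abs_pyramid (t - n • a)
    simp only [pyramid_sub, Pi.sub_apply, Finset.sum_sub_distrib, Pi.smul_apply, smul_eq_mul,
      ← Finset.mul_sum, ha.2, mul_one] at this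
    exact this
  refine (emd_le_sum_abs_pyramid (fun x => hb.1 x) (fun x => ha.1 x) (by rw [hb.2, ha.2])).trans ?_
  suffices h : ∑ c, |pyramid (normalize t : Grid ℓ → ℝ) c - pyramid a c| ≤ 4 / n * E by
    calc _ ≤ 2 * (4 / n * E) := by linarith
      _ = _ := by ring
  by_cases h0 : t = 0
  · have h1 : n ≤ E := by
      rw [h0] at hm
      simpa [abs_of_pos hn] using hm
    calc ∑ c, |pyramid (normalize t : Grid ℓ → ℝ) c - pyramid a c|
        ≤ ∑ c, (pyramid (normalize t : Grid ℓ → ℝ) c + pyramid a c) := by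
          refine Finset.sum_le_sum fun c _ => ?_
          have h2 := pyramid_nonneg (s := (normalize t : Grid ℓ → ℝ)) (fun x => hb.1 x) c
          have h3 := pyramid_nonneg (s := a) (fun x => ha.1 x) c
          rw [abs_le]; constructor <;> linarith
      _ ≤ 4 := by
          rw [Finset.sum_add_distrib]
          have h2 := sum_pyramid_le (s := (normalize t : Grid ℓ → ℝ)) (fun x => hb.1 x)
          have h3 := sum_pyramid_le (s := a) (fun x => ha.1 x)
          rw [hb.2] at h2
          rw [ha.2] at h3
          linarith
      _ ≤ 4 / n * E := by rw [div_mul_eq_mul_div, le_div_iff₀ hn]; linarith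
  · have hM : 0 < ∑ x, t x := by
      refine lt_of_le_of_ne (Finset.sum_nonneg fun x _ => ht x) fun h => h0 ?_
      rw [eq_comm, Finset.sum_eq_zero_iff_of_nonneg fun x _ => ht x] at h
      exact funext fun x => h x (Finset.mem_univ x)
    set M := ∑ x, t x with hMdef
    have hnorm : (normalize t : Grid ℓ → ℝ) = M⁻¹ • t := by
      rw [normalize, dif_pos ⟨ht, h0⟩]
      rfl
    rw [hnorm]
    calc ∑ c, |pyramid (M⁻¹ • t) c - pyramid a c|
        ≤ ∑ c, (|M⁻¹ - n⁻¹| * pyramid t c + n⁻¹ * |pyramid t c - pyramid (n • a) c|) := by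
          refine Finset.sum_le_sum fun c _ => ?_
          rw [pyramid_smul, pyramid_smul]
          have h2 : M⁻¹ * pyramid t c - pyramid a c =
              (M⁻¹ - n⁻¹) * pyramid t c + n⁻¹ * (pyramid t c - n * pyramid a c) := by
            field_simp; ring
          rw [h2]
          refine (abs_add_le _ _).trans (le_of_eq ?_)
          rw [abs_mul, abs_mul, abs_of_nonneg (pyramid_nonneg ht c),
            abs_of_pos (inv_pos.2 hn)]
      _ ≤ |M⁻¹ - n⁻¹| * (2 * M) + n⁻¹ * E := by
          rw [Finset.sum_add_distrib, ← Finset.mul_sum, ← Finset.mul_sum]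
          have := mul_le_mul_of_nonneg_left (sum_pyramid_le ht) (abs_nonneg (M⁻¹ - n⁻¹))
          linarith
      _ = 2 / n * |M - n| + n⁻¹ * E := by
          have h3 : M⁻¹ - n⁻¹ = -(M - n) * (M⁻¹ * n⁻¹) := by field_simp; ring
          rw [h3, abs_mul, abs_neg, abs_of_pos (a := M⁻¹ * n⁻¹) (by positivity)]
          field_simp
      _ ≤ 2 / n * E + n⁻¹ * E := by gcongr
      _ ≤ 4 / n * E := by
          have hE0 : 0 ≤ E := (abs_nonneg _).trans hm
          have : 0 ≤ n⁻¹ * E := by positivity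
          rw [div_eq_mul_inv, div_eq_mul_inv]; linarith

-- The deterministic accuracy bound, with `48 = 8 * 2 * 3` from normalization, minimization and
-- greedy search, and `96 = 48 * 2` from `sum_pyramid_far_le`.
open Classical in
lemma emd_normalize_le_cost {ℓ w k r : ℕ} (hr : 1 ≤ r) (hw : k * (2 * r + 1) ^ 2 ≤ w)
    {a a' : Grid ℓ → ℝ} (ha : a ∈ stdSimplex ℝ (Grid ℓ)) (ha' : a' ∈ sparseDists ℓ k)
    {γ : Grid ℓ → Grid ℓ → ℝ} (hγ : γ ∈ couplings a' a) {n : ℝ} (hn : 0 < n) {y : Cell ℓ → ℝ}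
    {S : ∀ i : ℕ, Finset (Grid i)} (hS : IsGreedyTree w y S) {t : Grid ℓ → ℝ}
    (ht : IsLPSolution (restrictTo y S) t) :
    emd (normalize t : Grid ℓ → ℝ) a ≤ 96 / r * ∑ x, ∑ y, γ x y * l1Dist x y +
      48 / n * ∑ c : Cell ℓ with c.2 ∈ candidates S c.1, |y c - pyramid (n • a) c| := by
  set T : Finset (Grid ℓ) := (Function.support a').toFinite.toFinset with hT
  have hTcard : T.card ≤ k := by
    rw [hT, ← Set.ncard_eq_toFinset_card]
    exact ha'.2
  have ha0 : ∀ x ∉ T, a' x = 0 := fun x hx => by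
    by_contra h
    exact hx (by simpa [hT] using h)
  have hs : 0 ≤ n • a := fun x => mul_nonneg hn.le (ha.1 x)
  have h1 := sum_abs_restrictTo_sub_pyramid_le (W := near r T) hs hS
    (fun i => (card_near_le r T i).trans ((Nat.mul_le_mul_right _ hTcard).trans hw))
    (fun i c hc => anc_mem_near hr hc)
  have h2 := ht.sum_abs_pyramid_sub_le hs
  have h3 := emd_normalize_le ht.1 ha hn
  have h4 := sum_pyramid_far_le hr T ha0 hγ
  have h5 : ∑ c : Cell ℓ with c.2 ∉ near r T c.1, pyramid (n • a) c =
      n * ∑ c : Cell ℓ with c.2 ∉ near r T c.1, pyramid a c := by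
    simp only [pyramid_smul, Finset.mul_sum]
  rw [h5] at h1
  set N := ∑ c : Cell ℓ with c.2 ∈ candidates S c.1, |y c - pyramid (n • a) c|
  set K := ∑ x, ∑ y, γ x y * l1Dist x y
  set F := ∑ c : Cell ℓ with c.2 ∉ near r T c.1, pyramid a c
  calc emd (normalize t : Grid ℓ → ℝ) a
      ≤ 8 / n * (2 * (3 * (n * F) + 3 * N)) :=
        h3.trans (mul_le_mul_of_nonneg_left (by linarith) (by positivity))
    _ = 48 * F + 48 / n * N := by field_simp; ring
    _ ≤ 48 * (2 / r * K) + 48 / n * N := by linarith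
    _ = _ := by ring

/-! ### Measurable implementations of the reconstruction -/

lemma exists_subset_card_eq_of_top {α : Type*} [DecidableEq α] (f : α → ℝ) (T : Finset α) (m : ℕ)
    (hm : m ≤ T.card) :
    ∃ S ⊆ T, S.card = m ∧ ∀ p ∈ S, ∀ q ∈ T, q ∉ S → f q ≤ f p := by
  induction m with
  | zero => exact ⟨∅, by simp⟩
  | succ m ih =>
    obtain ⟨S, hST, hc, hS⟩ := ih (by omega)
    have hne : (T \ S).Nonempty := by
      rw [← Finset.card_pos, Finset.card_sdiff_of_subset hST]; omega
    obtain ⟨x, hx, hmax⟩ := Finset.exists_max_image (T \ S) f hne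
    obtain ⟨hxT, hxS⟩ := Finset.mem_sdiff.1 hx
    refine ⟨insert x S, Finset.insert_subset hxT hST, by rw [Finset.card_insert_of_notMem hxS, hc],
      fun p hp q hq hqS => ?_⟩
    rw [Finset.mem_insert, not_or] at hqS
    rcases Finset.mem_insert.1 hp with rfl | hp
    · exact hmax q (Finset.mem_sdiff.2 ⟨hq, hqS.2⟩)
    · exact hS p hp q hq hqS.2

lemma exists_isGreedyTree {ℓ : ℕ} (w : ℕ) (y : Cell ℓ → ℝ) : ∃ S, IsGreedyTree w y S := by
  classical
  choose pick hsub hcard hmax using fun (i : ℕ) (S : Finset (Grid i)) =>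
    exists_subset_card_eq_of_top
      (fun c : Grid (i + 1) => if h : i + 1 < ℓ + 1 then y ⟨⟨i + 1, h⟩, c⟩ else 0)
      (children S) (min w (children S).card) (min_le_right _ _)
  let S : ∀ i : ℕ, Finset (Grid i) := fun i =>
    Nat.rec (motive := fun i => Finset (Grid i)) Finset.univ (fun i S => pick i S) i
  refine ⟨S, rfl, fun i hi => ⟨hsub i (S i), hcard i (S i), fun p hp q hq hqS => ?_⟩⟩
  simpa only [dif_pos hi] using hmax i (S i) p hp q hq hqS

/-- A tree given by its levels `0, …, ℓ`. -/
def ofLevels {ℓ : ℕ} (S : ∀ i : Fin (ℓ + 1), Finset (Grid i)) (i : ℕ) : Finset (Grid i) :=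
  if h : i < ℓ + 1 then S ⟨i, h⟩ else ∅

/-- Levels beyond `ℓ` are unconstrained, so trees may be taken from a finite type; measurability
arguments use this. -/
lemma IsGreedyTree.ofLevels {ℓ w : ℕ} {y : Cell ℓ → ℝ} {S : ∀ i : ℕ, Finset (Grid i)}
    (hS : IsGreedyTree w y S) :
    IsGreedyTree w y (ofLevels fun i : Fin (ℓ + 1) => S i) := by
  have h : ∀ i < ℓ + 1, SparseEMD.ofLevels (fun i : Fin (ℓ + 1) => S i) i = S i := fun i hi => by
    simp only [SparseEMD.ofLevels, dif_pos hi]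
  refine ⟨(h 0 (by omega)).trans hS.1, fun i hi => ?_⟩
  rw [h i (by omega), h (i + 1) hi]
  exact hS.2 i hi

lemma measurableSet_isGreedyTree {ℓ : ℕ} (w : ℕ) (S : ∀ i : ℕ, Finset (Grid i)) :
    MeasurableSet {y : Cell ℓ → ℝ | IsGreedyTree w y S} :=
  measurableSet_setOfPred.2 <| measurable_const.and <| Measurable.forall fun _ => Measurable.forall
    fun _ => measurable_const.and <| measurable_const.and <| Measurable.forall fun _ =>
      Measurable.forall fun _ => Measurable.forall fun _ => Measurable.forall fun _ =>
        Measurable.forall fun _ => measurableSet_setOfPred.1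
          (measurableSet_le (measurable_pi_apply _) (measurable_pi_apply _))

lemma measurable_restrictTo {ℓ : ℕ} (S : ∀ i : ℕ, Finset (Grid i)) :
    Measurable fun y : Cell ℓ → ℝ => restrictTo y S := by
  refine measurable_pi_iff.2 fun c => ?_
  unfold restrictTo
  split_ifs
  exacts [measurable_pi_apply c, measurable_const]

/-- A closed relation with non-empty convex fibres has a measurable selection: the element of
minimal norm of each fibre. -/
theorem exists_measurable_selection_of_isClosed {Z E : Type*} [TopologicalSpace Z]
    [MeasurableSpace Z] [OpensMeasurableSpace Z] [NormedAddCommGroup E] [NormedSpace ℝ E]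
    [StrictConvexSpace ℝ E] [ProperSpace E] [MeasurableSpace E] [BorelSpace E]
    {G : Set (Z × E)} (hG : IsClosed G) (hne : ∀ z, ∃ s, (z, s) ∈ G)
    (hconv : ∀ z, Convex ℝ {s | (z, s) ∈ G}) :
    ∃ L : Z → E, Measurable L ∧ ∀ z, (z, L z) ∈ G := by
  have hclosed : ∀ z, IsClosed {s | (z, s) ∈ G} := fun z => hG.preimage (by fun_prop)
  have hmin : ∀ s : Set E, IsClosed s → s.Nonempty → ∃ x ∈ s, ∀ y ∈ s, ‖x‖ ≤ ‖y‖ := by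
    intro s hs hs'
    obtain ⟨x, hx, hd⟩ := hs.exists_infDist_eq_dist hs' 0
    refine ⟨x, hx, fun y hy => ?_⟩
    have := Metric.infDist_le_dist_of_mem (x := (0 : E)) hy
    rwa [hd, dist_zero_left, dist_zero_left] at this
  choose L hL hLmin using fun z => hmin _ (hclosed z) (hne z)
  refine ⟨L, ?_, hL⟩
  -- Projection along a compact factor is a closed map.
  have hproj : ∀ (C : Set E) (q : ℝ), IsClosed C →
      IsClosed {z | ∃ s ∈ C, (z, s) ∈ G ∧ ‖s‖ ≤ q} := by
    intro C q hC
    have hK : IsCompact (C ∩ Metric.closedBall 0 q) := (isCompact_closedBall 0 q).inter_left hC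
    have : CompactSpace ↥(C ∩ Metric.closedBall (0 : E) q) := isCompact_iff_compactSpace.1 hK
    have h1 : IsClosed ((fun p : Z × ↥(C ∩ Metric.closedBall (0 : E) q) => (p.1, (p.2 : E))) ⁻¹' G) :=
      hG.preimage (by fun_prop)
    convert isClosedMap_fst_of_compactSpace _ h1 using 1
    ext z
    simp only [Set.mem_ofPred_eq, Set.mem_image, Set.mem_preimage, Prod.exists, exists_and_right,
      exists_eq_right, Subtype.exists, Set.mem_inter_iff, mem_closedBall_zero_iff]
    constructor
    · rintro ⟨s, h1, h2, h3⟩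
      exact ⟨s, ⟨h1, h3⟩, h2⟩
    · rintro ⟨s, ⟨h1, h3⟩, h2⟩
      exact ⟨s, h1, h2, h3⟩
  refine measurable_of_isClosed fun C hC => ?_
  -- `L z ∈ C` iff every rational ball meeting the fibre also meets its part in `C`. Otherwise, by
  -- uniqueness of the minimizer (strict convexity), that part has strictly larger least norm, and a
  -- rational in between gives a contradiction.
  have heq : L ⁻¹' C = ⋂ q : ℚ, ({z | ∃ s ∈ Set.univ, (z, s) ∈ G ∧ ‖s‖ ≤ (q : ℝ)}ᶜ ∪
      {z | ∃ s ∈ C, (z, s) ∈ G ∧ ‖s‖ ≤ (q : ℝ)}) := by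
    ext z
    simp only [Set.mem_preimage, Set.mem_iInter, Set.mem_union, Set.mem_compl_iff,
      Set.mem_ofPred_eq, Set.mem_univ, true_and]
    constructor
    · intro hz q
      by_cases h : ∃ s, (z, s) ∈ G ∧ ‖s‖ ≤ (q : ℝ)
      · obtain ⟨s, hs, hsq⟩ := h
        exact Or.inr ⟨L z, hz, hL z, (hLmin z s hs).trans hsq⟩
      · exact Or.inl h
    · intro h
      by_contra hz
      have hex : ∀ q : ℚ, ‖L z‖ ≤ q → ∃ s ∈ C, (z, s) ∈ G ∧ ‖s‖ ≤ (q : ℝ) := fun q hq =>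
        (h q).resolve_left fun h' => h' ⟨L z, hL z, hq⟩
      obtain ⟨q₀, hq₀⟩ := exists_rat_gt ‖L z‖
      obtain ⟨s₀, hs₀C, hs₀, -⟩ := hex q₀ hq₀.le
      obtain ⟨s, ⟨hsC, hsG⟩, hsmin⟩ := hmin (C ∩ {s | (z, s) ∈ G}) (hC.inter (hclosed z))
        ⟨s₀, hs₀C, hs₀⟩
      have hlt : ‖L z‖ < ‖s‖ := by
        refine lt_of_le_of_ne (hLmin z s hsG) fun he => ?_
        have hne' : L z ≠ s := fun h' => hz (h' ▸ hsC)
        have h1 := (norm_midpoint_lt_iff he).2 hne'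
        have h2 := hconv z (hL z) hsG (a := 1 / 2) (b := 1 / 2) (by norm_num) (by norm_num)
          (by norm_num)
        rw [← smul_add] at h2
        exact absurd (hLmin z _ h2) (not_le.2 h1)
      obtain ⟨q, hq1, hq2⟩ := exists_rat_btwn hlt
      obtain ⟨t, htC, htG, htq⟩ := hex q hq1.le
      exact absurd (hsmin t ⟨htC, htG⟩) (not_le.2 (htq.trans_lt hq2))
  rw [heq]
  exact MeasurableSet.iInter fun q =>
    (hproj _ _ isClosed_univ).measurableSet.compl.union (hproj _ _ hC).measurableSet

lemma continuous_pyramid {ℓ : ℕ} (c : Cell ℓ) : Continuous fun s : Grid ℓ → ℝ => pyramid s c := by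
  simp only [pyramid, levelSum_eq]
  fun_prop

lemma exists_isLPSolution {ℓ : ℕ} (z : Cell ℓ → ℝ) : ∃ s, IsLPSolution z s := by
  -- A competitor with a coordinate above `B` has mass above `B` and is no better than `0`, so
  -- minimizing over a compact box suffices.
  set B := 2 * ∑ c, |z c| with hB
  have hB0 : 0 ≤ B := by positivity
  have hcont : Continuous fun s : Grid ℓ → ℝ => ∑ c, |z c - pyramid s c| :=
    continuous_finsetSum _ fun c _ => (continuous_const.sub (continuous_pyramid c)).abs
  have h0 : (0 : Grid ℓ → ℝ) ∈ Set.Icc (0 : Grid ℓ → ℝ) (fun _ => B) := ⟨le_rfl, fun _ => hB0⟩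
  obtain ⟨s, hs, hmin⟩ := isCompact_Icc.exists_isMinOn ⟨_, h0⟩ hcont.continuousOn
  refine ⟨s, hs.1, fun s' hs' => ?_⟩
  by_cases h : s' ∈ Set.Icc (0 : Grid ℓ → ℝ) (fun _ => B)
  · exact hmin h
  · refine (hmin h0).trans ?_
    have h1 : ∃ x, B < s' x := by
      by_contra! h'
      exact h ⟨hs', h'⟩
    obtain ⟨x, hx⟩ := h1
    have h2 : s' x ≤ ∑ x, s' x :=
      Finset.single_le_sum (f := s') (fun x _ => hs' x) (Finset.mem_univ x)
    have h3 := abs_sum_le_sum_abs_pyramid s'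
    have h4 := le_abs_self (∑ x, s' x)
    have h5 : ∑ c, |pyramid s' c| ≤ ∑ c, |z c - pyramid s' c| + ∑ c, |z c| := by
      rw [← Finset.sum_add_distrib]
      refine Finset.sum_le_sum fun c _ => ?_
      have := abs_sub_le (pyramid s' c) (z c) 0
      rwa [sub_zero, sub_zero, abs_sub_comm] at this
    have h6 : ∀ c : Cell ℓ, pyramid (0 : Grid ℓ → ℝ) c = 0 := fun c => by
      simp [pyramid, levelSum_eq]
    simp only [h6, sub_zero]
    linarith

lemma convex_isLPSolution {ℓ : ℕ} (z : Cell ℓ → ℝ) : Convex ℝ {s | IsLPSolution z s} := by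
  intro s hs t ht a b ha hb hab
  refine ⟨add_nonneg (smul_nonneg ha hs.1) (smul_nonneg hb ht.1), fun s' hs' => ?_⟩
  calc ∑ c, |z c - pyramid (a • s + b • t) c|
      ≤ ∑ c, (a * |z c - pyramid s c| + b * |z c - pyramid t c|) := by
        refine Finset.sum_le_sum fun c _ => ?_
        have h1 : z c - pyramid (a • s + b • t) c =
            a * (z c - pyramid s c) + b * (z c - pyramid t c) := by
          have h2 : pyramid (a • s + b • t) c = a * pyramid s c + b * pyramid t c := by
            simp only [pyramid, levelSum_add, levelSum_smul]; ring
          rw [h2]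
          linear_combination (-(z c)) * hab
        rw [h1]
        refine (abs_add_le _ _).trans (le_of_eq ?_)
        rw [abs_mul, abs_mul, abs_of_nonneg ha, abs_of_nonneg hb]
    _ = a * ∑ c, |z c - pyramid s c| + b * ∑ c, |z c - pyramid t c| := by
        rw [Finset.sum_add_distrib, Finset.mul_sum, Finset.mul_sum]
    _ ≤ a * ∑ c, |z c - pyramid s' c| + b * ∑ c, |z c - pyramid s' c| :=
        add_le_add (mul_le_mul_of_nonneg_left (hs.2 s' hs') ha)
          (mul_le_mul_of_nonneg_left (ht.2 s' hs') hb)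
    _ = _ := by rw [← add_mul, hab, one_mul]

lemma exists_measurable_isLPSolution (ℓ : ℕ) :
    ∃ L : (Cell ℓ → ℝ) → (Grid ℓ → ℝ), Measurable L ∧ ∀ z, IsLPSolution z (L z) := by
  -- The Euclidean norm supplies the strict convexity that the sup norm of `Grid ℓ → ℝ` lacks.
  let G : Set ((Cell ℓ → ℝ) × EuclideanSpace ℝ (Grid ℓ)) := {p | IsLPSolution p.1 p.2.ofLp}
  have hpyr : ∀ c : Cell ℓ, Continuous fun p : (Cell ℓ → ℝ) × EuclideanSpace ℝ (Grid ℓ) =>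
      pyramid p.2.ofLp c := fun c => (continuous_pyramid c).comp (by fun_prop)
  have hG : IsClosed G := by
    have : G = {p | 0 ≤ p.2.ofLp} ∩ ⋂ s' : {s' : Grid ℓ → ℝ // 0 ≤ s'},
        {p | ∑ c, |p.1 c - pyramid p.2.ofLp c| ≤ ∑ c, |p.1 c - pyramid s'.1 c|} := by
      ext p
      simp [G, IsLPSolution]
    rw [this]
    refine (isClosed_le (by fun_prop) (by fun_prop)).inter (isClosed_iInter fun s' =>
      isClosed_le ?_ ?_)
    · exact continuous_finsetSum _ fun c _ =>
        (((continuous_apply c).comp continuous_fst).sub (hpyr c)).abs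
    · fun_prop
  obtain ⟨L, hL, hLG⟩ := exists_measurable_selection_of_isClosed hG
    (fun z => by
      obtain ⟨s, hs⟩ := exists_isLPSolution z
      exact ⟨WithLp.toLp 2 s, hs⟩)
    (fun z => (convex_isLPSolution z).linear_preimage
      (WithLp.linearEquiv 2 ℝ (Grid ℓ → ℝ)).toLinearMap)
  exact ⟨fun z => (L z).ofLp, (WithLp.measurable_ofLp _ _).comp hL, hLG⟩

theorem exists_isReconstruct (ℓ w : ℕ) :
    ∃ R : (Cell ℓ → ℝ) → (Grid ℓ → ℝ), IsReconstruct w R := by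
  classical
  obtain ⟨L, hL, hLs⟩ := exists_measurable_isLPSolution ℓ
  obtain ⟨e, he⟩ := exists_surjective_nat (∀ i : Fin (ℓ + 1), Finset (Grid i))
  have hex : ∀ y : Cell ℓ → ℝ, ∃ n, IsGreedyTree w y (ofLevels (e n)) := by
    intro y
    obtain ⟨S, hS⟩ := exists_isGreedyTree w y
    obtain ⟨n, hn⟩ := he fun i => S i
    exact ⟨n, hn ▸ hS.ofLevels⟩
  refine ⟨fun y => L (restrictTo y (ofLevels (e (Nat.find (hex y))))), ?_, fun y =>
    ⟨_, Nat.find_spec (hex y), hLs _⟩⟩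
  exact Measurable.find (f := fun n y => L (restrictTo y (ofLevels (e n))))
    (fun n => hL.comp (measurable_restrictTo _)) (fun n => measurableSet_isGreedyTree w _) hex

lemma measurable_normalize {ℓ : ℕ} : Measurable (normalize : (Grid ℓ → ℝ) → Dist ℓ) := by
  classical
  refine measurable_comap_iff.2 ?_
  have h : (Subtype.val ∘ normalize : (Grid ℓ → ℝ) → Grid ℓ → ℝ) = fun s =>
      if 0 ≤ s ∧ s ≠ 0 then (∑ x, s x)⁻¹ • s
      else (stdSimplex.barycenter : Dist ℓ).1 := by
    funext s
    simp only [Function.comp_apply, normalize]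
    split_ifs <;> rfl
  rw [h]
  refine Measurable.ite ?_ (by fun_prop) measurable_const
  exact (measurableSet_le measurable_const measurable_id).inter
    (measurableSet_singleton (0 : Grid ℓ → ℝ)).compl

/-! ### The Laplace distribution -/

lemma integral_exp_neg_abs_div {b : ℝ} (hb : 0 < b) : ∫ x : ℝ, Real.exp (-|x| / b) = 2 * b := by
  rw [integral_comp_abs (f := fun x => Real.exp (-x / b))]
  have h := Real.integral_rpow_mul_exp_neg_mul_Ioi (a := 1) (r := 1 / b) one_pos (by positivity)
  simp only [sub_self, Real.rpow_zero, one_mul, Real.rpow_one, Real.Gamma_one, mul_one,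
    one_div_one_div] at h
  congr 1
  refine Eq.trans ?_ h
  congr 2
  ext x
  ring_nf

lemma integral_abs_mul_exp_neg_abs_div {b : ℝ} (hb : 0 < b) :
    ∫ x : ℝ, |x| * Real.exp (-|x| / b) = 2 * b ^ 2 := by
  rw [integral_comp_abs (f := fun x => x * Real.exp (-x / b))]
  have h := Real.integral_rpow_mul_exp_neg_mul_Ioi (a := 2) (r := 1 / b) two_pos (by positivity)
  norm_num at h
  rw [← h]
  congr 2
  ext x
  ring_nf

/-- The integral of a non-integrable function is `0` by convention. -/
lemma integrable_of_integral_pos {f : ℝ → ℝ} (h : 0 < ∫ x, f x) : Integrable f :=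
  not_imp_comm.1 integral_undef h.ne'

lemma measurable_laplace_density (b : ℝ) :
    Measurable fun x : ℝ => ENNReal.ofReal ((2 * b)⁻¹ * Real.exp (-|x| / b)) := by
  fun_prop

lemma isProbabilityMeasure_laplace {b : ℝ} (hb : 0 < b) : IsProbabilityMeasure (laplace b) := by
  constructor
  rw [laplace, withDensity_apply _ MeasurableSet.univ, Measure.restrict_univ,
    ← ofReal_integral_eq_lintegral_ofReal]
  · rw [integral_const_mul, integral_exp_neg_abs_div hb, inv_mul_cancel₀ (by positivity),
      ENNReal.ofReal_one]
  · refine (integrable_of_integral_pos ?_).const_mul _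
    rw [integral_exp_neg_abs_div hb]; positivity
  · exact Filter.Eventually.of_forall fun x => by positivity

lemma lintegral_abs_laplace {b : ℝ} (hb : 0 < b) :
    ∫⁻ x, ENNReal.ofReal |x| ∂laplace b = ENNReal.ofReal b := by
  rw [laplace, lintegral_withDensity_eq_lintegral_mul _ (measurable_laplace_density b)
    (by fun_prop)]
  have h : ∀ x : ℝ, ((fun x : ℝ => ENNReal.ofReal ((2 * b)⁻¹ * Real.exp (-|x| / b))) *
      fun x => ENNReal.ofReal |x|) x =
      ENNReal.ofReal ((2 * b)⁻¹ * (|x| * Real.exp (-|x| / b))) := fun x => by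
    rw [Pi.mul_apply, ← ENNReal.ofReal_mul (by positivity)]
    ring_nf
  simp only [h]
  rw [← ofReal_integral_eq_lintegral_ofReal]
  · rw [integral_const_mul, integral_abs_mul_exp_neg_abs_div hb]
    congr 1
    field_simp
  · refine (integrable_of_integral_pos ?_).const_mul _
    rw [integral_abs_mul_exp_neg_abs_div hb]; positivity
  · exact Filter.Eventually.of_forall fun x => by positivity

lemma laplace_singleton (b t : ℝ) : laplace b {t} = 0 :=
  withDensity_absolutelyContinuous _ _ (measure_singleton t)

/-- Translating by `t` changes the density by a factor of at most `exp (|t| / b)`. -/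
lemma lintegral_add_right_laplace_le {b : ℝ} (hb : 0 < b) {g : ℝ → ENNReal} (hg : Measurable g)
    (t : ℝ) :
    ∫⁻ x, g (x + t) ∂laplace b ≤ ENNReal.ofReal (Real.exp (|t| / b)) * ∫⁻ x, g x ∂laplace b := by
  have hd := measurable_laplace_density b
  rw [laplace, lintegral_withDensity_eq_lintegral_mul _ hd
      (show Measurable fun x => g (x + t) from hg.comp (measurable_add_const t)),
    lintegral_withDensity_eq_lintegral_mul _ hd hg, ← lintegral_const_mul _ (hd.mul hg)]
  simp only [Pi.mul_apply]
  rw [← lintegral_sub_right_eq_self _ t]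
  refine lintegral_mono fun x => ?_
  simp only [sub_add_cancel]
  rw [← mul_assoc, ← ENNReal.ofReal_mul (by positivity)]
  refine mul_le_mul_left (ENNReal.ofReal_le_ofReal ?_) _
  have h1 : Real.exp (-|x - t| / b) ≤ Real.exp (|t| / b) * Real.exp (-|x| / b) := by
    rw [← Real.exp_add, Real.exp_le_exp, ← add_div]
    refine div_le_div_of_nonneg_right ?_ hb.le
    have := abs_sub_abs_le_abs_sub x t
    linarith
  calc (2 * b)⁻¹ * Real.exp (-|x - t| / b)
      ≤ (2 * b)⁻¹ * (Real.exp (|t| / b) * Real.exp (-|x| / b)) :=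
        mul_le_mul_of_nonneg_left h1 (by positivity)
    _ = _ := by ring

/-! ### Product noise and privacy -/

lemma isProbabilityMeasure_noise {ℓ : ℕ} {levelEps : Fin (ℓ + 1) → ℝ} (h : ∀ i, 0 < levelEps i) :
    IsProbabilityMeasure (noise levelEps) := by
  have := fun c : Cell ℓ => isProbabilityMeasure_laplace (one_div_pos.2 (h c.1))
  unfold noise
  infer_instance

lemma lintegral_noise_add_single_le {ℓ : ℕ} {levelEps : Fin (ℓ + 1) → ℝ}
    (h : ∀ i, 0 < levelEps i) {f : (Cell ℓ → ℝ) → ENNReal} (hf : Measurable f) (c : Cell ℓ)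
    (t : ℝ) :
    ∫⁻ ν, f (ν + Pi.single c t) ∂noise levelEps ≤
      ENNReal.ofReal (Real.exp (levelEps c.1 * |t|)) * ∫⁻ ν, f ν ∂noise levelEps := by
  have := fun c : Cell ℓ => isProbabilityMeasure_laplace (one_div_pos.2 (h c.1))
  rw [← lintegral_const_mul _ hf]
  refine lintegral_le_of_lmarginal_le {c} (by fun_prop) (by fun_prop) ?_
  intro x
  rw [lmarginal_singleton, lmarginal_singleton]
  have hg : Measurable fun u => f (Function.update x c u) := hf.comp (measurable_update x)
  have key := lintegral_add_right_laplace_le (one_div_pos.2 (h c.1)) hg t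
  beta_reduce
  rw [lintegral_const_mul _ hg]
  have h1 : ∀ u, Function.update x c u + Pi.single c t = Function.update x c (u + t) := by
    intro u
    ext d
    by_cases hd : d = c
    · subst hd; simp
    · simp [hd]
  simp only [h1]
  refine key.trans (le_of_eq ?_)
  congr 3
  field_simp

lemma lintegral_noise_add_le {ℓ : ℕ} {levelEps : Fin (ℓ + 1) → ℝ} (h : ∀ i, 0 < levelEps i)
    {f : (Cell ℓ → ℝ) → ENNReal} (hf : Measurable f) (δ : Cell ℓ → ℝ) :
    ∫⁻ ν, f (ν + δ) ∂noise levelEps ≤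
      ENNReal.ofReal (Real.exp (∑ c, levelEps c.1 * |δ c|)) * ∫⁻ ν, f ν ∂noise levelEps := by
  -- Shift one coordinate at a time; `f` is quantified inside because each shift changes it.
  suffices H : ∀ (A : Finset (Cell ℓ)) (f : (Cell ℓ → ℝ) → ENNReal), Measurable f →
      ∫⁻ ν, f (ν + ∑ c ∈ A, Pi.single c (δ c)) ∂noise levelEps ≤
        ENNReal.ofReal (Real.exp (∑ c ∈ A, levelEps c.1 * |δ c|)) * ∫⁻ ν, f ν ∂noise levelEps by
    have := H Finset.univ f hf
    rwa [Finset.univ_sum_single] at this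
  intro A
  induction A using Finset.induction_on with
  | empty => intro f hf; simp
  | insert c A hc ih =>
    intro f hf
    have h1 := lintegral_noise_add_single_le h
      (hf.comp (measurable_add_const (∑ c ∈ A, Pi.single c (δ c)))) c (δ c)
    simp only [Function.comp_apply, add_assoc] at h1
    rw [Finset.sum_insert hc, Finset.sum_insert hc, Real.exp_add,
      ENNReal.ofReal_mul (by positivity), mul_assoc]
    exact h1.trans (mul_le_mul_right (ih f hf) _)

lemma measurable_measurements {ℓ : ℕ} (s : Grid ℓ → ℝ) :
    Measurable (measurements s : (Cell ℓ → ℝ) → Cell ℓ → ℝ) := by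
  unfold measurements
  fun_prop

lemma measurable_dpSparseEMDAgg_map {ℓ : ℕ} {R : (Cell ℓ → ℝ) → (Grid ℓ → ℝ)} (hR : Measurable R)
    (s : Grid ℓ → ℝ) : Measurable fun ν => normalize (R (measurements s ν)) :=
  measurable_normalize.comp (hR.comp (measurable_measurements s))

lemma measurements_add {ℓ : ℕ} (s p : Grid ℓ → ℝ) (ν : Cell ℓ → ℝ) :
    measurements (s + p) ν = measurements s (ν + fun c => levelSum p c.2) := by
  ext c
  simp only [measurements, levelSum_add, Pi.add_apply]
  ring

/-- Adding or removing a user amounts to translating the noise by level sums whose absolute values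
total 1 at each level. -/
lemma lintegral_noise_measurements_add_le {ℓ : ℕ} {levelEps : Fin (ℓ + 1) → ℝ}
    (h : ∀ i, 0 < levelEps i) {f : (Cell ℓ → ℝ) → ENNReal} (hf : Measurable f)
    (s p : Grid ℓ → ℝ) {q : Grid ℓ → ℝ} (hq : q ∈ stdSimplex ℝ (Grid ℓ)) (hp : p = q ∨ p = -q) :
    ∫⁻ ν, f (measurements (s + p) ν) ∂noise levelEps ≤
      ENNReal.ofReal (Real.exp (∑ i, levelEps i)) *
        ∫⁻ ν, f (measurements s ν) ∂noise levelEps := by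
  simp only [measurements_add]
  refine (lintegral_noise_add_le h (hf.comp (measurable_measurements s)) _).trans (le_of_eq ?_)
  have h1 : ∀ c : Cell ℓ, |levelSum p c.2| = levelSum q c.2 := by
    intro c
    have h2 := levelSum_nonneg (s := q) (fun x => hq.1 x) c.2
    rcases hp with rfl | rfl
    · exact abs_of_nonneg h2
    · have h3 : levelSum (-q) c.2 = -levelSum q c.2 := by simp [levelSum_eq]
      rw [h3, abs_neg, abs_of_nonneg h2]
  simp only [h1]
  congr 3
  rw [Fintype.sum_sigma]
  refine Finset.sum_congr rfl fun i _ => ?_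
  simp only
  rw [← Finset.mul_sum, sum_levelSum, hq.2, mul_one]

theorem isDP_dpSparseEMDAgg {ℓ : ℕ} {levelEps : Fin (ℓ + 1) → ℝ} (h : ∀ i, 0 < levelEps i)
    {R : (Cell ℓ → ℝ) → (Grid ℓ → ℝ)} (hR : Measurable R) :
    IsDP (∑ i, levelEps i) (dpSparseEMDAgg levelEps R) := by
  have hprob := isProbabilityMeasure_noise h
  refine ⟨fun X => Measure.isProbabilityMeasure_map (measurable_dpSparseEMDAgg_map hR _).aemeasurable,
    fun X X' hXX' O hO => ?_⟩
  have hM : ∀ X, dpSparseEMDAgg levelEps R X O =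
      ∫⁻ ν, (O.indicator 1 (normalize (R (measurements (total X) ν))) : ENNReal)
        ∂noise levelEps := by
    intro X
    rw [dpSparseEMDAgg, ← lintegral_indicator_one hO,
      lintegral_map (measurable_one.indicator hO) (measurable_dpSparseEMDAgg_map hR _)]
  have hf : Measurable fun y => (O.indicator 1 (normalize (R y)) : ENNReal) :=
    (measurable_one.indicator hO).comp (measurable_normalize.comp hR)
  have htot : ∀ (p : Dist ℓ) (X : Dataset ℓ), total (p ::ₘ X) = total X + (p : Grid ℓ → ℝ) := by
    intro p X
    simp [total, add_comm]
  rw [hM, hM]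
  obtain ⟨p, rfl | rfl⟩ := hXX'
  · have := lintegral_noise_measurements_add_le h hf (total (p ::ₘ X)) (-(p : Grid ℓ → ℝ)) p.2
      (Or.inr rfl)
    rwa [htot, add_neg_cancel_right, ← htot] at this
  · rw [htot]
    exact lintegral_noise_measurements_add_le h hf _ _ p.2 (Or.inl rfl)

/-! ### The expected noise on the candidate cells -/

/-- Independence, as Fubini in the coordinate `c`. -/
lemma lintegral_noise_mul {ℓ : ℕ} {levelEps : Fin (ℓ + 1) → ℝ} (h : ∀ i, 0 < levelEps i)
    {f : (Cell ℓ → ℝ) → ENNReal} (hf : Measurable f) {c : Cell ℓ}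
    (hfc : ∀ ν t, f (Function.update ν c t) = f ν) {g : ℝ → ENNReal} (hg : Measurable g) :
    ∫⁻ ν, f ν * g (ν c) ∂noise levelEps =
      (∫⁻ ν, f ν ∂noise levelEps) * ∫⁻ x, g x ∂laplace (1 / levelEps c.1) := by
  have := fun c : Cell ℓ => isProbabilityMeasure_laplace (one_div_pos.2 (h c.1))
  rw [← lintegral_mul_const _ hf]
  refine lintegral_eq_of_lmarginal_eq {c} (by fun_prop) (by fun_prop) ?_
  rw [lmarginal_singleton, lmarginal_singleton]
  ext x
  simp only [hfc, Function.update_self]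
  rw [lintegral_const_mul _ hg, lintegral_const, measure_univ, mul_one]

lemma noise_setOf_eq {ℓ : ℕ} {levelEps : Fin (ℓ + 1) → ℝ} (h : ∀ i, 0 < levelEps i)
    {c d : Cell ℓ} (hcd : c ≠ d) (t : ℝ) : noise levelEps {ν | ν c = ν d + t} = 0 := by
  have := fun c : Cell ℓ => isProbabilityMeasure_laplace (one_div_pos.2 (h c.1))
  have hm : MeasurableSet {ν : Cell ℓ → ℝ | ν c = ν d + t} :=
    measurableSet_eq_fun (by fun_prop) (by fun_prop)
  rw [← lintegral_indicator_one hm, ← lintegral_zero (μ := noise levelEps)]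
  refine lintegral_eq_of_lmarginal_eq {c} (measurable_one.indicator hm) measurable_const ?_
  rw [lmarginal_singleton, lmarginal_singleton]
  ext x
  have h1 : ∀ u, ({ν : Cell ℓ → ℝ | ν c = ν d + t}.indicator 1 (Function.update x c u) : ENNReal) =
      ({x d + t} : Set ℝ).indicator 1 u := by
    intro u
    simp [Set.indicator, Function.update_of_ne hcd.symm]
  simp only [h1]
  rw [lintegral_indicator_one (measurableSet_singleton _), laplace_singleton, lintegral_zero]

/-- No two cells of the same level have the same measurement. -/
def NoTies {ℓ : ℕ} (y : Cell ℓ → ℝ) : Prop :=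
  ∀ (i : Fin (ℓ + 1)) (c d : Grid i), c ≠ d → y ⟨i, c⟩ ≠ y ⟨i, d⟩

/-- Without ties the search has one outcome, which makes the noise bound uniform over all
tie-breaking rules. -/
lemma ae_noTies {ℓ : ℕ} {levelEps : Fin (ℓ + 1) → ℝ} (h : ∀ i, 0 < levelEps i)
    (s : Grid ℓ → ℝ) : ∀ᵐ ν ∂noise levelEps, NoTies (measurements s ν) := by
  simp only [NoTies, ae_all_iff]
  intro i c d hcd
  have hne : (⟨i, c⟩ : Cell ℓ) ≠ ⟨i, d⟩ := fun h => hcd (by simpa using h)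
  refine measure_mono_null (fun ν hν => ?_) (noise_setOf_eq h hne (levelSum s d - levelSum s c))
  have h1 : measurements s ν ⟨i, c⟩ = measurements s ν ⟨i, d⟩ := by simpa using hν
  have h2 := mul_left_cancel₀ (show ((2 : ℝ) ^ (i : ℕ))⁻¹ ≠ 0 by positivity) h1
  change ν ⟨i, c⟩ = ν ⟨i, d⟩ + _
  simp only at h2
  linarith

/-- The greedy search conditions at the levels below `m`. -/
def IsGreedyBelow {ℓ : ℕ} (m w : ℕ) (y : Cell ℓ → ℝ) (S : ∀ i : ℕ, Finset (Grid i)) : Prop :=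
  S 0 = Finset.univ ∧
  ∀ (i : ℕ) (hi : i + 1 < ℓ + 1), i + 1 < m →
    S (i + 1) ⊆ children (S i) ∧
    (S (i + 1)).card = min w (children (S i)).card ∧
    ∀ p ∈ S (i + 1), ∀ q ∈ children (S i), q ∉ S (i + 1) →
      y ⟨⟨i + 1, hi⟩, q⟩ ≤ y ⟨⟨i + 1, hi⟩, p⟩

lemma IsGreedyTree.isGreedyBelow {ℓ w : ℕ} {y : Cell ℓ → ℝ} {S : ∀ i : ℕ, Finset (Grid i)}
    (hS : IsGreedyTree w y S) (m : ℕ) : IsGreedyBelow m w y S :=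
  ⟨hS.1, fun i hi _ => hS.2 i hi⟩

lemma measurableSet_isGreedyBelow {ℓ : ℕ} (m w : ℕ) (S : ∀ i : ℕ, Finset (Grid i)) :
    MeasurableSet {y : Cell ℓ → ℝ | IsGreedyBelow m w y S} :=
  measurableSet_setOfPred.2 <| measurable_const.and <| Measurable.forall fun _ => Measurable.forall
    fun _ => Measurable.forall fun _ => measurable_const.and <| measurable_const.and <|
      Measurable.forall fun _ => Measurable.forall fun _ => Measurable.forall fun _ =>
        Measurable.forall fun _ => Measurable.forall fun _ => measurableSet_setOfPred.1
          (measurableSet_le (measurable_pi_apply _) (measurable_pi_apply _))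

/-- The cell `c` can be a candidate of the greedy search. -/
def IsReachable {ℓ : ℕ} (w : ℕ) (y : Cell ℓ → ℝ) (c : Cell ℓ) : Prop :=
  ∃ S : ∀ i : Fin (ℓ + 1), Finset (Grid i),
    IsGreedyBelow c.1 w y (ofLevels S) ∧ c.2 ∈ candidates (ofLevels S) c.1

lemma measurableSet_isReachable {ℓ : ℕ} (w : ℕ) (c : Cell ℓ) :
    MeasurableSet {y : Cell ℓ → ℝ | IsReachable w y c} :=
  measurableSet_setOfPred.2 <| Measurable.exists fun S =>
    (measurableSet_setOfPred.1 (measurableSet_isGreedyBelow c.1 w (ofLevels S))).and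
      measurable_const

/-- Reachability of `c` involves only measurements at levels strictly below `c.1`; hence it is
independent of the noise at `c`. -/
lemma isReachable_congr {ℓ w : ℕ} {y z : Cell ℓ → ℝ} {c : Cell ℓ} (h : ∀ d, d ≠ c → y d = z d) :
    IsReachable w y c ↔ IsReachable w z c := by
  have key : ∀ (i : ℕ) (hi : i + 1 < ℓ + 1), i + 1 < (c.1 : ℕ) → ∀ q : Grid (i + 1),
      y ⟨⟨i + 1, hi⟩, q⟩ = z ⟨⟨i + 1, hi⟩, q⟩ := by
    intro i hi hic q
    refine h _ fun he => ?_
    rw [← he] at hic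
    exact lt_irrefl _ hic
  unfold IsReachable IsGreedyBelow
  refine exists_congr fun S => and_congr_left fun _ => and_congr_right fun _ =>
    forall_congr' fun i => forall_congr' fun hi => forall_congr' fun hic => ?_
  simp only [key i hi hic]

lemma IsGreedyTree.isReachable {ℓ w : ℕ} {y : Cell ℓ → ℝ} {S : ∀ i : ℕ, Finset (Grid i)}
    (hS : IsGreedyTree w y S) {c : Cell ℓ} (hc : c.2 ∈ candidates S c.1) : IsReachable w y c := by
  refine ⟨fun i => S i, hS.ofLevels.isGreedyBelow _, ?_⟩
  obtain ⟨⟨i, hi⟩, c⟩ := c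
  cases i with
  | zero => exact Finset.mem_univ _
  | succ i =>
    simp only [candidates] at hc ⊢
    have h : SparseEMD.ofLevels (fun i : Fin (ℓ + 1) => S i) i = S i := by
      simp only [SparseEMD.ofLevels, dif_pos (show i < ℓ + 1 by omega)]
    rwa [h]

lemma eq_of_top_of_injOn {α : Type*} {T A B : Finset α} {f : α → ℝ}
    (hf : ∀ c d, c ≠ d → f c ≠ f d) (hAT : A ⊆ T) (hBT : B ⊆ T) (hcard : A.card = B.card)
    (hA : ∀ p ∈ A, ∀ q ∈ T, q ∉ A → f q ≤ f p) (hB : ∀ p ∈ B, ∀ q ∈ T, q ∉ B → f q ≤ f p) :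
    A = B := by
  refine Finset.eq_of_subset_of_card_le (fun p hp => ?_) hcard.ge
  by_contra hpB
  have hBA : ¬ B ⊆ A := fun h => hpB (Finset.eq_of_subset_of_card_le h hcard.le ▸ hp)
  obtain ⟨q, hq, hqA⟩ := Finset.not_subset.1 hBA
  refine hf p q (fun h => hqA (h ▸ hp)) (le_antisymm ?_ ?_)
  · exact hB q hq p (hAT hp) hpB
  · exact hA p hp q (hBT hq) hqA

lemma IsGreedyBelow.eq_of_noTies {ℓ m w : ℕ} {y : Cell ℓ → ℝ} (hy : NoTies y)
    {S S' : ∀ i : ℕ, Finset (Grid i)} (hS : IsGreedyBelow m w y S)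
    -- The case `i = 0` is separate because level 0 is fixed even when `m = 0`.
    (hS' : IsGreedyBelow m w y S') (i : ℕ) (hi : i < ℓ + 1) (him : i = 0 ∨ i < m) :
    S i = S' i := by
  induction i with
  | zero => rw [hS.1, hS'.1]
  | succ i ih =>
    have hm : i + 1 < m := by omega
    have h1 := hS.2 i hi hm
    have h2 := hS'.2 i hi hm
    rw [← ih (by omega) (by omega)] at h2
    exact eq_of_top_of_injOn (f := fun c => y ⟨⟨i + 1, hi⟩, c⟩) (hy ⟨i + 1, hi⟩) h1.1 h2.1
      (h1.2.1.trans h2.2.1.symm) h1.2.2 h2.2.2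

lemma IsGreedyBelow.card_le {ℓ m w : ℕ} (hw : 0 < w) {y : Cell ℓ → ℝ}
    {S : ∀ i : ℕ, Finset (Grid i)} (hS : IsGreedyBelow m w y S) (i : ℕ) (hi : i < ℓ + 1)
    (him : i = 0 ∨ i < m) : (S i).card ≤ w := by
  cases i with
  | zero =>
    rw [hS.1, Finset.card_univ, card_grid]
    exact hw
  | succ i =>
    rw [(hS.2 i hi (by omega)).2.1]
    exact min_le_left _ _

-- Without ties all searches agree before level `i`, so the reachable cells are children of a single
-- set of at most `w` cells.
open Classical in
lemma card_isReachable_le {ℓ w : ℕ} (hw : 0 < w) {y : Cell ℓ → ℝ} (hy : NoTies y)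
    (i : Fin (ℓ + 1)) :
    (Finset.univ.filter fun c : Grid i => IsReachable w y ⟨i, c⟩).card ≤
      min (4 ^ (i : ℕ)) (4 * w) := by
  have h0 : (Finset.univ.filter fun c : Grid i => IsReachable w y ⟨i, c⟩).card ≤ 4 ^ (i : ℕ) := by
    rw [← card_grid]
    exact Finset.card_le_univ _
  refine le_min h0 ?_
  obtain ⟨i, hi⟩ := i
  cases i with
  | zero =>
    have h1 : 4 ^ (((⟨0, hi⟩ : Fin (ℓ + 1))) : ℕ) = 1 := rfl
    omega
  | succ i =>
    rcases (Finset.univ.filter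
      fun c : Grid (i + 1) => IsReachable w y ⟨⟨i + 1, hi⟩, c⟩).eq_empty_or_nonempty with he | he
    · rw [he]; simp
    · obtain ⟨c₀, hc₀⟩ := he
      obtain ⟨S, hS, -⟩ := (Finset.mem_filter.1 hc₀).2
      have hsub : (Finset.univ.filter
          fun c : Grid (i + 1) => IsReachable w y ⟨⟨i + 1, hi⟩, c⟩) ⊆ children (ofLevels S i) := by
        intro c hc
        obtain ⟨S', hS', hcS'⟩ := (Finset.mem_filter.1 hc).2
        rw [hS.eq_of_noTies hy hS' i (by omega) (Or.inr (Nat.lt_succ_self i))]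
        exact hcS'
      refine (Finset.card_le_card hsub).trans ((card_children_le _).trans ?_)
      exact Nat.mul_le_mul_left 4 (hS.card_le hw i (by omega) (Or.inr (Nat.lt_succ_self i)))

open Classical in
/-- The total scaled noise on the cells that can be candidates of the greedy search. -/
noncomputable def candidateNoise {ℓ : ℕ} (w : ℕ) (s : Grid ℓ → ℝ) (ν : Cell ℓ → ℝ) : ENNReal :=
  ∑ c : Cell ℓ, (if IsReachable w (measurements s ν) c then 1 else 0) *
    ENNReal.ofReal (((2 : ℝ) ^ (c.1 : ℕ))⁻¹ * |ν c|)

open Classical in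
lemma measurable_isReachable_ite {ℓ : ℕ} (w : ℕ) (s : Grid ℓ → ℝ) (c : Cell ℓ) :
    Measurable fun ν : Cell ℓ → ℝ =>
      (if IsReachable w (measurements s ν) c then 1 else 0 : ENNReal) :=
  Measurable.ite (measurable_measurements s (measurableSet_isReachable w c))
    measurable_const measurable_const

open Classical in
lemma measurable_candidateNoise_summand {ℓ : ℕ} (w : ℕ) (s : Grid ℓ → ℝ) (c : Cell ℓ) :
    Measurable fun ν : Cell ℓ → ℝ =>
      (if IsReachable w (measurements s ν) c then 1 else 0) *
        ENNReal.ofReal (((2 : ℝ) ^ (c.1 : ℕ))⁻¹ * |ν c|) :=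
  (measurable_isReachable_ite w s c).mul (by fun_prop)

lemma measurable_candidateNoise {ℓ : ℕ} (w : ℕ) (s : Grid ℓ → ℝ) :
    Measurable (candidateNoise w s) :=
  Finset.measurable_fun_sum _ fun c _ => measurable_candidateNoise_summand w s c

open Classical in
lemma IsGreedyTree.sum_candidates_le {ℓ w : ℕ} {s : Grid ℓ → ℝ} {ν : Cell ℓ → ℝ}
    {S : ∀ i : ℕ, Finset (Grid i)} (hS : IsGreedyTree w (measurements s ν) S) :
    ENNReal.ofReal (∑ c : Cell ℓ with c.2 ∈ candidates S c.1,
      |measurements s ν c - pyramid s c|) ≤ candidateNoise w s ν := by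
  rw [ENNReal.ofReal_sum_of_nonneg fun c _ => abs_nonneg _, Finset.sum_filter]
  refine Finset.sum_le_sum fun c _ => ?_
  split_ifs with h1 h2 h2
  · rw [one_mul, measurements, pyramid, mul_add, add_sub_cancel_left, abs_mul,
      abs_of_nonneg (a := ((2 : ℝ) ^ (c.1 : ℕ))⁻¹) (by positivity)]
  · exact absurd (hS.isReachable h1) h2
  · exact zero_le
  · exact zero_le

theorem lintegral_candidateNoise_le {ℓ w : ℕ} (hw : 0 < w) {levelEps : Fin (ℓ + 1) → ℝ}
    (h : ∀ i, 0 < levelEps i) (s : Grid ℓ → ℝ) :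
    ∫⁻ ν, candidateNoise w s ν ∂noise levelEps ≤
      ENNReal.ofReal (∑ i : Fin (ℓ + 1),
        ((2 : ℝ) ^ (i : ℕ))⁻¹ * min ((4 : ℝ) ^ (i : ℕ)) (4 * w) / levelEps i) := by
  classical
  have hprob := isProbabilityMeasure_noise h
  unfold candidateNoise
  rw [lintegral_finsetSum _ fun c _ => measurable_candidateNoise_summand w s c,
    ENNReal.ofReal_sum_of_nonneg fun i _ => by have := h i; positivity, Fintype.sum_sigma]
  refine Finset.sum_le_sum fun i _ => ?_
  have h1 : ∀ c : Grid i, ∫⁻ ν, (if IsReachable w (measurements s ν) ⟨i, c⟩ then 1 else 0) *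
      ENNReal.ofReal (((2 : ℝ) ^ (i : ℕ))⁻¹ * |ν ⟨i, c⟩|) ∂noise levelEps =
      (∫⁻ ν, (if IsReachable w (measurements s ν) ⟨i, c⟩ then 1 else 0) ∂noise levelEps) *
        ENNReal.ofReal (((2 : ℝ) ^ (i : ℕ))⁻¹ * (1 / levelEps i)) := by
    intro c
    rw [lintegral_noise_mul h (measurable_isReachable_ite w s ⟨i, c⟩)
      (g := fun x => ENNReal.ofReal (((2 : ℝ) ^ (i : ℕ))⁻¹ * |x|)) ?_ (by fun_prop)]
    · congr 1
      simp only [ENNReal.ofReal_mul (show (0 : ℝ) ≤ ((2 : ℝ) ^ (i : ℕ))⁻¹ by positivity)]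
      rw [lintegral_const_mul _ (by fun_prop), lintegral_abs_laplace (one_div_pos.2 (h i))]
    · intro ν t
      have : IsReachable w (measurements s (Function.update ν ⟨i, c⟩ t)) ⟨i, c⟩ ↔
          IsReachable w (measurements s ν) ⟨i, c⟩ :=
        isReachable_congr fun d hd => by simp [measurements, Function.update_of_ne hd]
      simp only [this]
  have h2 : ∑ c : Grid i, ∫⁻ ν, (if IsReachable w (measurements s ν) ⟨i, c⟩ then 1 else 0 : ENNReal)
      ∂noise levelEps ≤ ENNReal.ofReal (min ((4 : ℝ) ^ (i : ℕ)) (4 * w)) := by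
    rw [← lintegral_finsetSum _ fun c _ => measurable_isReachable_ite w s ⟨i, c⟩]
    calc _ ≤ ∫⁻ ν, ENNReal.ofReal (min ((4 : ℝ) ^ (i : ℕ)) (4 * w)) ∂noise levelEps := by
          refine lintegral_mono_ae ?_
          filter_upwards [ae_noTies h s] with ν hν
          rw [Finset.sum_boole, ← ENNReal.ofReal_natCast]
          refine ENNReal.ofReal_le_ofReal ?_
          exact_mod_cast card_isReachable_le hw hν i
      _ = _ := by rw [lintegral_const, measure_univ, mul_one]
  simp only [h1]
  rw [← Finset.sum_mul]
  refine (mul_le_mul_left h2 _).trans (le_of_eq ?_)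
  rw [← ENNReal.ofReal_mul (by positivity)]
  congr 1
  ring

/-! ### Choice of the privacy budgets -/

/-- The relative privacy budget of level `i`. -/
noncomputable def budget (b : ℝ) (i : ℕ) : ℝ := min (√2 ^ i) (b * (√2 ^ i)⁻¹)

lemma budget_pos {b : ℝ} (hb : 0 < b) (i : ℕ) : 0 < budget b i := by
  unfold budget; positivity

lemma sum_inv_sqrt_two_pow_le (n : ℕ) : ∑ i ∈ Finset.range n, (√2 ^ i)⁻¹ ≤ 4 := by
  have h0 : √2 ^ 2 = 2 := Real.sq_sqrt (by norm_num)
  have h1 : (4 : ℝ) / 3 ≤ √2 := Real.le_sqrt_of_sq_le (by norm_num)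
  have h2 : (√2)⁻¹ ≤ 3 / 4 := by
    rw [inv_le_comm₀ (by positivity) (by norm_num)]; linarith
  have h3 : (0 : ℝ) ≤ (√2)⁻¹ := by positivity
  simp only [← inv_pow]
  have hs := summable_geometric_of_lt_one h3 (by linarith)
  refine (hs.sum_le_tsum _ fun _ _ => by positivity).trans ?_
  rw [tsum_geometric_of_lt_one h3 (by linarith), inv_le_comm₀ (by linarith) (by norm_num)]
  linarith

/-- The budgets peak near `√2 ^ i = √b`, at height about `√b`, and decay geometrically on both
sides. -/
lemma sum_budget_le {b : ℝ} (hb : 1 ≤ b) (n : ℕ) :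
    ∑ i ∈ Finset.range n, budget b i ≤ 8 * √b := by
  have hx : 1 < √2 := Real.lt_sqrt_of_sq_lt (by norm_num)
  obtain ⟨m, hm1, hm2⟩ := exists_nat_pow_near (Real.one_le_sqrt.2 hb) hx
  have hb0 : 0 < b := by linarith
  have hsq : √b * √b = b := Real.mul_self_sqrt hb0.le
  have hsb : 0 < √b := Real.sqrt_pos.2 hb0
  have h1 : ∑ i ∈ Finset.range (m + 1), budget b i ≤ √b * 4 := by
    rw [← Finset.sum_range_reflect]
    refine le_trans ?_ (mul_le_mul_of_nonneg_left (sum_inv_sqrt_two_pow_le (m + 1)) hsb.le)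
    rw [Finset.mul_sum]
    refine Finset.sum_le_sum fun j hj => ?_
    have hj' : j ≤ m := Nat.lt_succ_iff.1 (Finset.mem_range.1 hj)
    refine (min_le_left _ _).trans ?_
    rw [← div_eq_mul_inv, le_div_iff₀ (by positivity), ← pow_add]
    have : m + 1 - 1 - j + j = m := by omega
    rw [this]
    exact hm1
  have h2 : ∑ j ∈ Finset.range n, budget b (m + 1 + j) ≤ √b * 4 := by
    refine le_trans ?_ (mul_le_mul_of_nonneg_left (sum_inv_sqrt_two_pow_le n) hsb.le)
    rw [Finset.mul_sum]
    refine Finset.sum_le_sum fun j _ => (min_le_right _ _).trans ?_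
    rw [pow_add, mul_inv, ← mul_assoc]
    refine mul_le_mul_of_nonneg_right ?_ (by positivity)
    rw [← div_eq_mul_inv, div_le_iff₀ (by positivity)]
    calc b = √b * √b := hsq.symm
      _ ≤ √b * √2 ^ (m + 1) := mul_le_mul_of_nonneg_left hm2.le hsb.le
  calc ∑ i ∈ Finset.range n, budget b i
      ≤ ∑ i ∈ Finset.range (m + 1 + n), budget b i :=
        Finset.sum_le_sum_of_subset_of_nonneg (Finset.range_mono (by omega))
          fun i _ _ => (budget_pos hb0 i).le
    _ = _ := Finset.sum_range_add _ _ _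
    _ ≤ 8 * √b := by linarith

/-- For fixed `∑ ε_i = ε`, the sum `∑ c_i / ε_i` is least when `ε_i` is proportional to `√c_i`, with
value `(∑ √c_i)² / ε`. Here `√c_i` is `budget b i` with `b = 2 * √w`, and `(8 * √b)² = 128 * √w`. -/
lemma exists_levelEps (ℓ : ℕ) {w : ℕ} (hw : 0 < w) {ε : ℝ} (hε : 0 < ε) :
    ∃ levelEps : Fin (ℓ + 1) → ℝ, (∀ i, 0 < levelEps i) ∧ ∑ i, levelEps i = ε ∧
      ∑ i : Fin (ℓ + 1), ((2 : ℝ) ^ (i : ℕ))⁻¹ * min ((4 : ℝ) ^ (i : ℕ)) (4 * w) / levelEps i ≤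
        128 * √w / ε := by
  have hw1 : (1 : ℝ) ≤ w := by exact_mod_cast hw
  set b : ℝ := 2 * √w with hb
  have hsw : 1 ≤ √(w : ℝ) := Real.one_le_sqrt.2 hw1
  have hb1 : 1 ≤ b := by linarith
  have hb0 : 0 < b := by linarith
  set V := ∑ i : Fin (ℓ + 1), budget b i with hV
  have hV0 : 0 < V := Finset.sum_pos (fun i _ => budget_pos hb0 i) Finset.univ_nonempty
  have hV8 : V ≤ 8 * √b := by
    rw [hV, Fin.sum_univ_eq_sum_range (budget b)]
    exact sum_budget_le hb1 _
  refine ⟨fun i => ε * budget b i / V, fun i => ?_, ?_, ?_⟩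
  · have := budget_pos hb0 i
    positivity
  · rw [← Finset.sum_div, ← Finset.mul_sum, ← hV, mul_div_assoc, div_self hV0.ne', mul_one]
  · have h1 : ∀ i : ℕ, ((2 : ℝ) ^ i)⁻¹ * min ((4 : ℝ) ^ i) (4 * w) = budget b i ^ 2 := by
      intro i
      have h2 : (2 : ℝ) ^ i = √2 ^ i * √2 ^ i := by
        rw [← mul_pow, Real.mul_self_sqrt (by norm_num)]
      have h4 : (4 : ℝ) ^ i = 2 ^ i * 2 ^ i := by rw [← mul_pow]; norm_num
      have hbb : b * b = 4 * w := by
        have := Real.mul_self_sqrt (show (0 : ℝ) ≤ w by linarith)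
        rw [hb]; linear_combination 4 * this
      have hp : 0 < √2 ^ i := by positivity
      unfold budget
      have h5 : min (√2 ^ i) (b * (√2 ^ i)⁻¹) = (√2 ^ i)⁻¹ * min (2 ^ i) b := by
        rw [mul_min_of_nonneg _ _ (by positivity), h2, inv_mul_cancel_left₀ hp.ne', mul_comm b]
      have h6 : min ((4 : ℝ) ^ i) (4 * w) = min (2 ^ i) b ^ 2 := by
        rw [h4, ← hbb, sq]
        rcases le_total ((2 : ℝ) ^ i) b with h | h
        · rw [min_eq_left h, min_eq_left (mul_le_mul h h (by positivity) hb0.le)]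
        · rw [min_eq_right h, min_eq_right (mul_le_mul h h hb0.le (by positivity))]
      rw [h5, h6, mul_pow, h2, inv_pow, sq (√2 ^ i)]
    calc ∑ i : Fin (ℓ + 1), ((2 : ℝ) ^ (i : ℕ))⁻¹ * min ((4 : ℝ) ^ (i : ℕ)) (4 * w) /
            (ε * budget b i / V)
        = ∑ i : Fin (ℓ + 1), V / ε * budget b i := by
          refine Finset.sum_congr rfl fun i _ => ?_
          rw [h1]
          have := budget_pos hb0 i
          field_simp
      _ = V * V / ε := by rw [← Finset.mul_sum, ← hV]; ring
      _ ≤ (8 * √b) * (8 * √b) / ε := by gcongr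
      _ = 128 * √w / ε := by
          have := Real.mul_self_sqrt hb0.le
          congr 1
          rw [hb] at this ⊢
          linear_combination 64 * this

/-! ### Accuracy of the mechanism -/

lemma total_eq_card_smul_average {ℓ : ℕ} {X : Dataset ℓ} (hX : X ≠ 0) :
    total X = (X.card : ℝ) • average X := by
  have : (X.card : ℝ) ≠ 0 := by simpa using hX
  rw [average, smul_inv_smul₀ this]

lemma average_mem_stdSimplex {ℓ : ℕ} {X : Dataset ℓ} (hX : X ≠ 0) :
    average X ∈ stdSimplex ℝ (Grid ℓ) := by
  have hcard : (X.card : ℝ) ≠ 0 := by simpa using hX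
  have h : (∀ x, 0 ≤ total X x) ∧ ∑ x, total X x = X.card := by
    clear hX hcard
    induction X using Multiset.induction_on with
    | empty => simp [total]
    | cons p X ih =>
      have htot : total (p ::ₘ X) = (p : Grid ℓ → ℝ) + total X := by simp [total]
      have h1 : ∀ x, 0 ≤ (p : Grid ℓ → ℝ) x := p.2.1
      have h2 : ∑ x, (p : Grid ℓ → ℝ) x = 1 := p.2.2
      rw [htot]
      refine ⟨fun x => add_nonneg (h1 x) (ih.1 x), ?_⟩
      simp only [Pi.add_apply]
      rw [Finset.sum_add_distrib, h2, ih.2, Multiset.card_cons]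
      push_cast; ring
  refine ⟨fun x => mul_nonneg (by positivity) (h.1 x), ?_⟩
  simp only [average, Pi.smul_apply, smul_eq_mul, ← Finset.mul_sum, h.2]
  exact inv_mul_cancel₀ hcard

lemma couplings_nonempty {ℓ : ℕ} {p q : Grid ℓ → ℝ} (hp : p ∈ stdSimplex ℝ (Grid ℓ))
    (hq : q ∈ stdSimplex ℝ (Grid ℓ)) : (couplings p q).Nonempty :=
  ⟨fun x y => p x * q y, fun x y => mul_nonneg (hp.1 x) (hq.1 y),
    fun x => by rw [← Finset.mul_sum, hq.2, mul_one],
    fun y => by rw [← Finset.sum_mul, hp.2, one_mul]⟩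

lemma sparseDists_nonempty (ℓ : ℕ) {k : ℕ} (hk : 1 ≤ k) : (sparseDists ℓ k).Nonempty := by
  classical
  refine ⟨Pi.single (0, 0) 1, single_mem_stdSimplex ℝ _, ?_⟩
  refine (Set.ncard_le_ncard (Pi.support_single_subset (i := ((0, 0) : Grid ℓ)))).trans ?_
  simpa using hk

/-- A bound for every sparse `a'` and every coupling passes to both infima without existence of
minimizers; the sets must be non-empty since `sInf ∅ = 0`. -/
lemma isApproximation_of_forall_coupling {ℓ k : ℕ} (hk : 1 ≤ k) {lam κ : ℝ} (hlam : 0 < lam)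
    {a : Grid ℓ → ℝ} (ha : a ∈ stdSimplex ℝ (Grid ℓ)) {b : Dist ℓ}
    (h : ∀ a' ∈ sparseDists ℓ k, ∀ γ ∈ couplings a' a,
      emd (b : Grid ℓ → ℝ) a ≤ lam * ∑ x, ∑ y, γ x y * l1Dist x y + κ) :
    IsApproximation k lam κ a b := by
  have h1 : (emd (b : Grid ℓ → ℝ) a - κ) / lam ≤ bestSparseError k a := by
    refine le_csInf ((sparseDists_nonempty ℓ hk).image _) ?_
    rintro _ ⟨a', ha', rfl⟩
    refine le_csInf ((couplings_nonempty ha'.1 ha).image _) ?_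
    rintro _ ⟨γ, hγ, rfl⟩
    rw [div_le_iff₀ hlam]
    linarith [h a' ha' γ hγ]
  rw [div_le_iff₀ hlam] at h1
  unfold IsApproximation
  linarith

theorem dpSparseEMDAgg_isApproximation {ℓ k r w : ℕ} (hk : 1 ≤ k) (hr : 1 ≤ r)
    (hw : w = k * (2 * r + 1) ^ 2) {ε lam : ℝ} (hε : 0 < ε) (hlam : 0 < lam)
    (hrlam : 96 / r ≤ lam) {levelEps : Fin (ℓ + 1) → ℝ} (hpos : ∀ i, 0 < levelEps i)
    (hsum : ∑ i : Fin (ℓ + 1), ((2 : ℝ) ^ (i : ℕ))⁻¹ * min ((4 : ℝ) ^ (i : ℕ)) (4 * w) / levelEps i ≤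
      128 * √w / ε)
    {R : (Cell ℓ → ℝ) → (Grid ℓ → ℝ)} (hR : IsReconstruct w R) {X : Dataset ℓ} (hX : X ≠ 0) :
    ENNReal.ofReal 0.99 ≤ dpSparseEMDAgg levelEps R X
      {b | IsApproximation k lam (48 / X.card * (100 * (128 * √w / ε))) (average X) b} := by
  classical
  have hprob := isProbabilityMeasure_noise hpos
  have hn : (0 : ℝ) < X.card := by
    have := Multiset.card_pos.2 hX
    exact_mod_cast this
  have hw0 : 0 < w := by rw [hw]; positivity
  have hw0' : (0 : ℝ) < w := by exact_mod_cast hw0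
  set B : ℝ := 128 * √w / ε with hB
  have hB0 : 0 < B := by positivity
  have ha := average_mem_stdSimplex hX
  set N := candidateNoise w (total X)
  -- This event depends on neither `R`, `a'` nor the coupling, so one exceptional set serves them
  -- all.
  have hmarkov : noise levelEps {ν | ENNReal.ofReal (100 * B) ≤ N ν} ≤ ENNReal.ofReal 0.01 := by
    have h1 := mul_meas_ge_le_lintegral (μ := noise levelEps)
      (measurable_candidateNoise w (total X)) (ENNReal.ofReal (100 * B))
    have h2 := h1.trans ((lintegral_candidateNoise_le hw0 hpos (total X)).trans
      (ENNReal.ofReal_le_ofReal hsum))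
    have h3 : ENNReal.ofReal B = ENNReal.ofReal (100 * B) * ENNReal.ofReal 0.01 := by
      rw [← ENNReal.ofReal_mul (by positivity)]
      congr 1
      ring
    rw [h3] at h2
    exact (ENNReal.mul_le_mul_iff_right (by simpa using hB0) ENNReal.ofReal_ne_top).1 h2
  have hgood : ENNReal.ofReal 0.99 ≤ noise levelEps {ν | ENNReal.ofReal (100 * B) ≤ N ν}ᶜ := by
    rw [prob_compl_eq_one_sub
      (measurableSet_le measurable_const (measurable_candidateNoise w (total X)))]
    refine le_trans ?_ (tsub_le_tsub_left hmarkov 1)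
    rw [← ENNReal.ofReal_one, ← ENNReal.ofReal_sub _ (by norm_num)]
    exact ENNReal.ofReal_le_ofReal (by norm_num)
  refine hgood.trans (le_trans (measure_mono fun ν hν => ?_)
    -- The inequality suffices and needs no measurability of the set of good outputs.
    (Measure.le_map_apply (measurable_dpSparseEMDAgg_map hR.1 _).aemeasurable _))
  have hν' : N ν < ENNReal.ofReal (100 * B) := not_le.1 hν
  obtain ⟨S, hS, hLP⟩ := hR.2 (measurements (total X) ν)
  have hN := hS.sum_candidates_le.trans hν'.le
  rw [ENNReal.ofReal_le_ofReal_iff (by positivity)] at hN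
  refine isApproximation_of_forall_coupling hk hlam ha fun a' ha' γ hγ => ?_
  have h1 := emd_normalize_le_cost hr hw.ge ha ha' hγ hn hS hLP
  rw [← total_eq_card_smul_average hX] at h1
  have hcost : 0 ≤ ∑ x, ∑ y, γ x y * l1Dist x y := Finset.sum_nonneg fun x _ =>
    Finset.sum_nonneg fun y _ => mul_nonneg (hγ.1 x y) (l1Dist_nonneg x y)
  refine h1.trans (add_le_add (mul_le_mul_of_nonneg_right hrlam hcost)
    (mul_le_mul_of_nonneg_left ?_ (by positivity)))
  exact hN

end SparseEMD

/-! ### Choice of the parameters and conclusion -/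

theorem mainTheorem1 :
    ∃ C : ℝ, 0 < C ∧
      ∀ (ε lam : ℝ), 0 < ε → 0 < lam → lam < 1 → ∀ (ℓ k : ℕ), 1 ≤ k →
        ∃ (w : ℕ) (levelEps : Fin (ℓ + 1) → ℝ),
          0 < w ∧ (∀ i, 0 < levelEps i) ∧
          (∃ R : (SparseEMD.Cell ℓ → ℝ) → (SparseEMD.Grid ℓ → ℝ), SparseEMD.IsReconstruct w R) ∧
          ∀ R : (SparseEMD.Cell ℓ → ℝ) → (SparseEMD.Grid ℓ → ℝ), SparseEMD.IsReconstruct w R →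
            SparseEMD.IsDP ε (SparseEMD.dpSparseEMDAgg levelEps R) ∧
            ∀ X : SparseEMD.Dataset ℓ, X ≠ 0 →
              ENNReal.ofReal 0.99 ≤
                SparseEMD.dpSparseEMDAgg levelEps R X
                  {b | SparseEMD.IsApproximation k lam
                    (C * (√(k : ℝ) / (lam * ε * (X.card : ℝ)))) (SparseEMD.average X) b} := by
  -- `48` is the noise factor of `emd_normalize_le_cost`, `100` comes from Markov's inequality,
  -- `128` from `exists_levelEps`, and `195` from `2 * r + 1 ≤ 195 / lam`.
  refine ⟨48 * 100 * 128 * 195, by norm_num, fun ε lam hε hlam hlam1 ℓ k hk => ?_⟩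
  set r : ℕ := ⌈96 / lam⌉₊ with hrdef
  have hr1 : 96 / lam ≤ r := Nat.le_ceil _
  have hr2 : (r : ℝ) < 96 / lam + 1 := Nat.ceil_lt_add_one (by positivity)
  have hr : 1 ≤ r := Nat.ceil_pos.2 (by positivity)
  have hr0 : (0 : ℝ) < r := by exact_mod_cast hr
  set w := k * (2 * r + 1) ^ 2 with hw
  have hw0 : 0 < w := by positivity
  obtain ⟨levelEps, hpos, htot, hsum⟩ := SparseEMD.exists_levelEps ℓ hw0 hε
  refine ⟨w, levelEps, hw0, hpos, SparseEMD.exists_isReconstruct ℓ w, fun R hR => ⟨?_, ?_⟩⟩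
  · rw [← htot]
    exact SparseEMD.isDP_dpSparseEMDAgg hpos hR.1
  · intro X hX
    have hrlam : 96 / (r : ℝ) ≤ lam := by
      rw [div_le_iff₀ hr0]
      rw [div_le_iff₀ hlam] at hr1
      linarith
    refine (SparseEMD.dpSparseEMDAgg_isApproximation hk hr hw hε hlam hrlam hpos hsum hR
      hX).trans (measure_mono fun b hb => ?_)
    have hn : (0 : ℝ) < X.card := by
      have := Multiset.card_pos.2 hX
      exact_mod_cast this
    refine le_trans (show SparseEMD.emd _ _ ≤ _ from hb) (add_le_add le_rfl ?_)
    have hsqrt : √(w : ℝ) = √k * (2 * r + 1) := by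
      rw [hw]
      push_cast
      rw [Real.sqrt_mul (by positivity), Real.sqrt_sq (by positivity)]
    -- `2 * r + 1 < 192 / lam + 3`, and `3 ≤ 3 / lam` because `lam < 1`.
    have h195 : (2 * r + 1 : ℝ) ≤ 195 / lam := by
      have h1 : (1 : ℝ) ≤ 1 / lam := by rw [le_div_iff₀ hlam]; linarith
      have h2 : 195 / lam = 2 * (96 / lam) + 3 * (1 / lam) := by ring
      linarith
    calc 48 / (X.card : ℝ) * (100 * (128 * √w / ε))
        = 48 * 100 * 128 * (√k * (2 * r + 1)) / (ε * X.card) := by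
          rw [hsqrt]; field_simp
      _ ≤ 48 * 100 * 128 * (√k * (195 / lam)) / (ε * X.card) := by gcongr
      _ = _ := by field_simp
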